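/- Let $m,N\ge 2$ be integers, let $p>1$, and let $W:\mathbb M^{m\times N}\to[0,+\infty]$ be Borel measurable and $p$-coercive, i.e. there is $C>0$ with $W(F)\ge C|F|^p$ for all $F$, where $\mathbb M^{m\times N}$ is the space of real $m\times N$ matrices. Let $Y=\,]0,1[^N$. For a bounded open set $D\subset\mathbb R^N$ let $W^{1,\infty}_0(D;\mathbb R^m)$ be the set of $\varphi\in W^{1,\infty}(D;\mathbb R^m)$ that are continuous on $\overline D$ and vanish on $\partial D$, and let $\mathrm{Aff}_0(Y;\mathbb R^m)$ be the set of continuous piecewise affine functions vanishing on $\partial Y$, i.e. of those $\varphi\in W^{1,\infty}_0(Y;\mathbb R^m)$ for which there are a finite family $(V_i)$ of pairwise disjoint open subsets of $Y$ with $|\partial V_i|=0$ and $|Y\setminus\bigcup_i V_i|=0$, and matrices $F_i$, such that $\nabla\varphi=F_i$ a.e. in $V_i$. Define, for $F\in\mathbb M^{m\times N}$, $$\mathcal Z_\infty W(F)=\inf\Big\{\int_Y W(F+\nabla\varphi(y))\,dy:\varphi\in W^{1,\infty}_0(Y;\mathbb R^m)\Big\},\qquad \mathcal Z W(F)=\inf\Big\{\int_Y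 W(F+\nabla\varphi(y))\,dy:\varphi\in \mathrm{Aff}_0(Y;\mathbb R^m)\Big\}.$$ A Borel function $g:\mathbb M^{m\times N}\to[0,+\infty]$ is called quasiconvex if $|D|\,g(F)\le\int_D g(F+\nabla\varphi(x))\,dx$ for every $F\in\mathbb M^{m\times N}$, every bounded open $D\subset\mathbb R^N$ with $|\partial D|=0$ and every $\varphi\in W^{1,\infty}_0(D;\mathbb R^m)$. Let $\mathcal Q W$ be the quasiconvex envelope of $W$, i.e. the pointwise supremum of all quasiconvex functions $g\le W$. (i) If $\mathcal Z_\infty W$ is finite (i.e. $\mathcal Z_\infty W(F)<+\infty$ for every $F$), then $\mathcal Q W$ is the greatest quasiconvex function lying below $W$, and $\mathcal Q W=\mathcal Z_\infty W$. (ii) If $\mathcal Z W$ is finite, then $\mathcal Q W$ is the greatest quasiconvex function lying below $W$, and $\mathcal Q W=\mathcal Z W=\mathcal Z_\infty W$. -/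

import Mathlib

open MeasureTheory Set
open scoped ENNReal ContDiff

namespace Relaxation

/-- Real `m × N` matrices. -/
abbrev Mat (m N : ℕ) : Type := Matrix (Fin m) (Fin N) ℝ

/-- Matrices carry the Borel σ-algebra of their usual (entrywise) topology. -/
instance instMeasurableSpaceMat (m N : ℕ) : MeasurableSpace (Mat m N) := borel _

instance instBorelSpaceMat (m N : ℕ) : BorelSpace (Mat m N) := ⟨rfl⟩

/-- The Euclidean (Frobenius) norm of a matrix. -/
noncomputable def matNorm {m N : ℕ} (F : Mat m N) : ℝ :=
  Real.sqrt (∑ i, ∑ j, F i j ^ 2)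

/-- `p`-coercivity: there is `C > 0` with `W F ≥ C |F|^p` for all `F`. -/
def IsCoercive {m N : ℕ} (p : ℝ) (W : Mat m N → ℝ≥0∞) : Prop :=
  ∃ C : ℝ, 0 < C ∧ ∀ F : Mat m N, ENNReal.ofReal (C * matNorm F ^ p) ≤ W F

/-- The open unit cube `]0,1[^N`. -/
def unitCube (N : ℕ) : Set (EuclideanSpace ℝ (Fin N)) :=
  {x | ∀ i, 0 < x i ∧ x i < 1}

/-- `φ` belongs to the Sobolev space `W^{1,∞}(D; ℝ^m)` and `G` is its weak gradient on `D`: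
`φ` and `G` are essentially bounded on `D`, and
`∫_D φ_i ∂_j η = - ∫_D G_{ij} η` for all `η ∈ C_c^∞(D)`, all `i` and `j`. -/
structure IsW1Inf {m N : ℕ} (D : Set (EuclideanSpace ℝ (Fin N)))
    (φ : EuclideanSpace ℝ (Fin N) → EuclideanSpace ℝ (Fin m))
    (G : EuclideanSpace ℝ (Fin N) → Mat m N) : Prop where
  memLp : MemLp φ ∞ (volume.restrict D)
  memLp_grad : ∀ i j, MemLp (fun x => G x i j) ∞ (volume.restrict D)
  weak_grad : ∀ η : EuclideanSpace ℝ (Fin N) → ℝ,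
    ContDiff ℝ ∞ η → HasCompactSupport η → tsupport η ⊆ D →
      ∀ i j, ∫ x in D, φ x i * fderiv ℝ η x (EuclideanSpace.single j 1)
        = - ∫ x in D, G x i j * η x

/-- `φ` is (the representative, continuous on the closure of `D`, of) an element of
`W^{1,∞}_0(D; ℝ^m) = {φ ∈ W^{1,∞}(D; ℝ^m) : φ = 0 on ∂D}`, with weak gradient `G`. -/
structure IsW1InfZero {m N : ℕ} (D : Set (EuclideanSpace ℝ (Fin N)))
    (φ : EuclideanSpace ℝ (Fin N) → EuclideanSpace ℝ (Fin m))
    (G : EuclideanSpace ℝ (Fin N) → Mat m N) : Prop extends IsW1Inf D φ G where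
  continuousOn : ContinuousOn φ (closure D)
  eq_zero : ∀ x ∈ frontier D, φ x = 0

/-- The weak gradient `G` is piecewise constant on `D`: there are finitely many pairwise disjoint
open sets `V i ⊆ D` with negligible boundaries, covering almost all of `D`, and matrices `A i`
such that the gradient equals `A i` in `V i`. -/
def IsPiecewiseConst {m N : ℕ} (D : Set (EuclideanSpace ℝ (Fin N)))
    (G : EuclideanSpace ℝ (Fin N) → Mat m N) : Prop :=
  ∃ (n : ℕ) (V : Fin n → Set (EuclideanSpace ℝ (Fin N))) (A : Fin n → Mat m N),
    (∀ i, IsOpen (V i)) ∧ (∀ i, V i ⊆ D) ∧ (∀ i j, i ≠ j → Disjoint (V i) (V j)) ∧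
    (∀ i, volume (frontier (V i)) = 0) ∧ volume (D \ ⋃ i, V i) = 0 ∧
    ∀ i, ∀ᵐ x ∂(volume.restrict (V i)), G x = A i

/-- `φ` is a continuous piecewise affine function on `D` vanishing on `∂D`, with gradient `G`. -/
structure IsAffZero {m N : ℕ} (D : Set (EuclideanSpace ℝ (Fin N)))
    (φ : EuclideanSpace ℝ (Fin N) → EuclideanSpace ℝ (Fin m))
    (G : EuclideanSpace ℝ (Fin N) → Mat m N) : Prop extends IsW1InfZero D φ G where
  piecewise : IsPiecewiseConst D G

/-- `Z_∞ W (F) = inf { ∫_Y W (F + ∇φ) : φ ∈ W^{1,∞}_0(Y; ℝ^m) }`. -/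
noncomputable def ZInf {m N : ℕ} (W : Mat m N → ℝ≥0∞) (F : Mat m N) : ℝ≥0∞ :=
  ⨅ (φ : EuclideanSpace ℝ (Fin N) → EuclideanSpace ℝ (Fin m))
    (G : EuclideanSpace ℝ (Fin N) → Mat m N) (_ : IsW1InfZero (unitCube N) φ G),
    ∫⁻ y in unitCube N, W (F + G y)

/-- `Z W (F) = inf { ∫_Y W (F + ∇φ) : φ ∈ Aff_0(Y; ℝ^m) }`. -/
noncomputable def ZAff {m N : ℕ} (W : Mat m N → ℝ≥0∞) (F : Mat m N) : ℝ≥0∞ :=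
  ⨅ (φ : EuclideanSpace ℝ (Fin N) → EuclideanSpace ℝ (Fin m))
    (G : EuclideanSpace ℝ (Fin N) → Mat m N) (_ : IsAffZero (unitCube N) φ G),
    ∫⁻ y in unitCube N, W (F + G y)

/-- Quasiconvexity of a Borel function with values in `[0,+∞]`:
`|D| g(F) ≤ ∫_D g(F + ∇φ)` for every matrix `F`, every bounded open set `D` with `|∂D| = 0` and
every `φ ∈ W^{1,∞}_0(D; ℝ^m)`. -/
structure IsQuasiconvex {m N : ℕ} (g : Mat m N → ℝ≥0∞) : Prop where
  measurable : Measurable g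
  le_lintegral : ∀ (F : Mat m N) (D : Set (EuclideanSpace ℝ (Fin N))),
    IsOpen D → Bornology.IsBounded D → volume (frontier D) = 0 →
    ∀ (φ : EuclideanSpace ℝ (Fin N) → EuclideanSpace ℝ (Fin m))
      (G : EuclideanSpace ℝ (Fin N) → Mat m N), IsW1InfZero D φ G →
      volume D * g F ≤ ∫⁻ x in D, g (F + G x)

/-- The quasiconvex functions lying below `W`. -/
def quasiconvexMinorants {m N : ℕ} (W : Mat m N → ℝ≥0∞) : Set (Mat m N → ℝ≥0∞) :=
  {g | IsQuasiconvex g ∧ g ≤ W}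

/-- The quasiconvex envelope `Q W`: the (pointwise) supremum of the quasiconvex functions lying
below `W`. -/
noncomputable def quasiconvexEnvelope {m N : ℕ} (W : Mat m N → ℝ≥0∞) : Mat m N → ℝ≥0∞ :=
  sSup (quasiconvexMinorants W)

end Relaxation

namespace Relaxation

open Filter Topology NNReal

/-! Both infima are instances of one quantity `relaxZ b W`, taken over Lipschitz functions vanishing
off the cube, with finitely many locally constant gradients demanded exactly when `b` holds
(`ZInf_eq_relaxZ`, `ZAff_eq_relaxZ`). A quasiconvex minorant of `W` lies below `ZInf W`, by its own
inequality on the cube, and `relaxZ b W ≤ W` by testing with zero. So everything reduces to the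
quasiconvexity of a finite `Z = relaxZ b W` (`isQuasiconvex_relaxZ`): then `Z` is the greatest
quasiconvex minorant, hence the envelope, for either choice of `b`, and the two infima agree when
both are finite.

Quasiconvexity is a Jensen inequality for `Z` along gradients. If `u` has finitely many gradients
`A`, fill each region where `∇u = A` with rescaled copies of a near-minimiser for `Z (F + A)`,
placed on a Vitali family of cubes (`Adm.exists_transplant`). The perturbed function competes for `Z
F`, and its energy is at most the integral of `Z (F + ∇u)` up to an arbitrary error
(`relaxZ_le_lintegral_relaxZ`).

General `u` require continuity of `Z`. Apply the first Jensen inequality to a laminate living in a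
slab of width `ε`: its gradient takes two opposite multiples of a matrix unit in the right
proportion, except in transition layers of volume `O(ε²)`. Dividing by `ε` and letting `ε → 0` gives
convexity of `Z` in each entry (`relaxZ_convex_entry`), and a finite nonnegative separately convex
function is continuous (`continuous_of_separately_convex`).

Dominated convergence then carries Jensen's inequality to smooth functions, approximated by
differences of maxima of tangent planes (`exists_piecewise_affine_approx`), and to Lipschitz
functions by mollification. A dilation into the cube handles other domains (`volume_mul_relaxZ_le`).
Elements of `W^{1,∞}_0` enter through `IsW1InfZero.lipschitz_indicator`: extended by zero they are
Lipschitz, and the weak gradient is the classical one almost everywhere. -/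

/-- Euclidean space of dimension `n`. -/
abbrev Euc (n : ℕ) : Type := EuclideanSpace ℝ (Fin n)

variable {m N : ℕ}

/-! ### Jacobian matrices -/

/-- The Jacobian matrix of `u` at `x`, defined through the Fréchet derivative. -/
noncomputable def gradMat (u : Euc N → Euc m) (x : Euc N) : Mat m N :=
  Matrix.of fun i j => fderiv ℝ u x (EuclideanSpace.single j 1) i

theorem gradMat_apply (u : Euc N → Euc m) (x : Euc N) (i : Fin m) (j : Fin N) :
    gradMat u x i j = fderiv ℝ u x (EuclideanSpace.single j 1) i := rfl

theorem measurable_mat_of_entries {α : Type*} [MeasurableSpace α] {f : α → Mat m N}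
    (h : ∀ i j, Measurable fun x => f x i j) : Measurable f := by
  have h1 : Measurable (fun x => (fun i j => f x i j : Fin m → Fin N → ℝ)) :=
    measurable_pi_iff.2 fun i => measurable_pi_iff.2 fun j => h i j
  have h2 : Continuous (fun g : Fin m → Fin N → ℝ => (Matrix.of g : Mat m N)) := continuous_id
  exact h2.measurable.comp h1

theorem measurable_gradMat (u : Euc N → Euc m) : Measurable (gradMat u) := by
  refine measurable_mat_of_entries fun i j => ?_
  have h := measurable_fderiv_apply_const ℝ u (EuclideanSpace.single j (1 : ℝ))
  exact (EuclideanSpace.proj (𝕜 := ℝ) i).continuous.measurable.comp h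

theorem gradMat_congr {u v : Euc N → Euc m} {x : Euc N} (h : u =ᶠ[𝓝 x] v) :
    gradMat u x = gradMat v x := by
  simp only [gradMat, h.fderiv_eq]

theorem gradMat_add {u v : Euc N → Euc m} {x : Euc N} (hu : DifferentiableAt ℝ u x)
    (hv : DifferentiableAt ℝ v x) :
    gradMat (fun y => u y + v y) x = gradMat u x + gradMat v x := by
  ext i j
  simp [gradMat_apply, fderiv_fun_add hu hv]

theorem gradMat_zero (x : Euc N) : gradMat (fun _ => (0 : Euc m)) x = 0 := by
  ext i j
  simp [gradMat_apply]

/-- The factors `r` and `r⁻¹` cancel, so shrinking a profile onto a small cube keeps its gradient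
values. No differentiability is required. -/
theorem gradMat_rescale (ψ : Euc N → Euc m) (a x : Euc N) {r : ℝ} (hr : r ≠ 0) :
    gradMat (fun x => r • ψ (r⁻¹ • (x - a))) x = gradMat ψ (r⁻¹ • (x - a)) := by
  have h1 : fderiv ℝ (fun x => r • ψ (r⁻¹ • (x - a))) x
      = r • fderiv ℝ (fun x => ψ (r⁻¹ • (x - a))) x :=
    congrFun (fderiv_const_smul_field (𝕜 := ℝ) (f := fun x => ψ (r⁻¹ • (x - a))) r) x
  have h2 : fderiv ℝ (fun x => ψ (r⁻¹ • (x - a))) x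
      = fderiv ℝ (fun x => ψ (r⁻¹ • x)) (x - a) :=
    fderiv_comp_sub (𝕜 := ℝ) (f := fun x => ψ (r⁻¹ • x)) a
  have h3 : fderiv ℝ (fun x => ψ (r⁻¹ • x)) (x - a) = r⁻¹ • fderiv ℝ ψ (r⁻¹ • (x - a)) :=
    fderiv_comp_smul (𝕜 := ℝ) (f := ψ) (x := x - a) r⁻¹
  have h : fderiv ℝ (fun x => r • ψ (r⁻¹ • (x - a))) x = fderiv ℝ ψ (r⁻¹ • (x - a)) := by
    rw [h1, h2, h3, smul_smul, mul_inv_cancel₀ hr, one_smul]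
  simp only [gradMat, h]

theorem abs_gradMat_le {u : Euc N → Euc m} {K : ℝ≥0} (hu : LipschitzWith K u) (x : Euc N)
    (i : Fin m) (j : Fin N) : |gradMat u x i j| ≤ K := by
  have h1 : ‖fderiv ℝ u x‖ ≤ K := norm_fderiv_le_of_lipschitz ℝ hu
  have h2 := (fderiv ℝ u x).le_opNorm (EuclideanSpace.single j (1 : ℝ))
  have h3 := PiLp.norm_apply_le (fderiv ℝ u x (EuclideanSpace.single j (1 : ℝ))) i
  rw [gradMat_apply, ← Real.norm_eq_abs]
  simp only [PiLp.norm_single, norm_one, mul_one] at h2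
  linarith

/-! ### Locally constant gradients and admissible functions -/

/-- Almost every point of `D` has a neighbourhood in which the gradient of `u` is almost everywhere
equal to an element of a fixed finite set. -/
def FinGrad (D : Set (Euc N)) (u : Euc N → Euc m) : Prop :=
  ∃ S : Set (Mat m N), S.Finite ∧ ∀ᵐ x ∂(volume.restrict D), ∃ A ∈ S,
    ∀ᶠ y in 𝓝 x ⊓ ae volume, gradMat u y = A

/-- Globally Lipschitz functions vanishing off `D`, with locally constant gradient taking finitely
many values if `b` holds. -/
structure Adm (b : Prop) (D : Set (Euc N)) (u : Euc N → Euc m) : Prop where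
  lipschitz : ∃ K, LipschitzWith K u
  zero_off : ∀ x ∉ D, u x = 0
  fin_grad : b → FinGrad D u

/-- Neighbourhoods have positive measure, so none is contained in a null set. Hence near a given
point the gradient is a.e. equal to at most one matrix. -/
instance neBot_nhds_inf_ae (x : Euc N) : (𝓝 x ⊓ ae (volume : Measure (Euc N))).NeBot := by
  rw [inf_neBot_iff]
  intro s hs t ht
  by_contra h
  rw [not_nonempty_iff_eq_empty] at h
  have h1 : s ⊆ tᶜ := fun y hy hyt => by
    have : y ∈ s ∩ t := ⟨hy, hyt⟩
    simp [h] at this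
  exact (Measure.measure_pos_of_mem_nhds volume hs).ne' (measure_mono_null h1 ht)

theorem eventually_nhds_inf_ae_of_isOpen {V : Set (Euc N)} (hV : IsOpen V) {x : Euc N} (hx : x ∈ V)
    {P : Euc N → Prop} (h : ∀ᵐ y ∂(volume.restrict V), P y) : ∀ᶠ y in 𝓝 x ⊓ ae volume, P y := by
  rw [ae_restrict_iff' hV.measurableSet] at h
  have h1 : ∀ᶠ y in 𝓝 x ⊓ ae (volume : Measure (Euc N)), y ∈ V :=
    Filter.Eventually.filter_mono inf_le_left (hV.mem_nhds hx)
  have h2 : ∀ᶠ y in 𝓝 x ⊓ ae (volume : Measure (Euc N)), y ∈ V → P y :=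
    Filter.Eventually.filter_mono inf_le_right h
  filter_upwards [h1, h2] with y hy hy' using hy' hy

/-- The open set near whose points the gradient of `u` is a.e. equal to `A`. -/
def gradRegion (u : Euc N → Euc m) (A : Mat m N) : Set (Euc N) :=
  {x | ∀ᶠ y in 𝓝 x ⊓ ae volume, gradMat u y = A}

theorem isOpen_gradRegion (u : Euc N → Euc m) (A : Mat m N) : IsOpen (gradRegion u A) := by
  rw [isOpen_iff_mem_nhds]
  intro x hx
  have hx' : ∀ᶠ y in 𝓝 x ⊓ ae volume, gradMat u y = A := hx
  rw [eventually_inf] at hx'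
  obtain ⟨s, hs, t, ht, hst⟩ := hx'
  obtain ⟨U, hU, hUo, hxU⟩ := mem_nhds_iff.1 hs
  filter_upwards [hUo.mem_nhds hxU] with z hz
  show ∀ᶠ y in 𝓝 z ⊓ ae volume, gradMat u y = A
  rw [eventually_inf]
  exact ⟨U, hUo.mem_nhds hz, t, ht, fun y hy => hst y ⟨hU hy.1, hy.2⟩⟩

theorem disjoint_gradRegion (u : Euc N → Euc m) {A B : Mat m N} (h : A ≠ B) :
    Disjoint (gradRegion u A) (gradRegion u B) := by
  rw [Set.disjoint_left]
  intro x hA hB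
  have hA' : ∀ᶠ y in 𝓝 x ⊓ ae volume, gradMat u y = A := hA
  have hB' : ∀ᶠ y in 𝓝 x ⊓ ae volume, gradMat u y = B := hB
  obtain ⟨y, hy⟩ := (hA'.and hB').exists
  exact h (hy.1.symm.trans hy.2)

/-- Each point of the region has a neighbourhood in which the exceptional set is null, and a locally
null set is null. -/
theorem ae_gradRegion (u : Euc N → Euc m) (A : Mat m N) :
    ∀ᵐ x ∂(volume.restrict (gradRegion u A)), gradMat u x = A := by
  rw [ae_restrict_iff' (isOpen_gradRegion u A).measurableSet, ae_iff]
  refine measure_null_of_locally_null _ fun x hx => ?_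
  simp only [mem_ofPred_eq, Classical.not_imp] at hx
  have h := hx.1
  change ∀ᶠ y in 𝓝 x ⊓ ae volume, gradMat u y = A at h
  rw [eventually_inf] at h
  obtain ⟨s, hs, t, ht, hst⟩ := h
  refine ⟨s ∩ {x | ¬ (x ∈ gradRegion u A → gradMat u x = A)},
    inter_mem (mem_nhdsWithin_of_mem_nhds hs) self_mem_nhdsWithin, ?_⟩
  refine measure_mono_null (t := tᶜ) ?_ ht
  rintro y ⟨hy, hy'⟩ hyt
  exact hy' fun _ => hst y ⟨hy, hyt⟩

/-! ### Gluing -/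

/-- Lipschitz functions supported in pairwise disjoint sets can be glued. -/
theorem exists_lipschitz_glue {ι : Type*} {C : ι → Set (Euc N)} (hC : Pairwise (Function.onFun Disjoint C))
    {ψ : ι → Euc N → Euc m} {K : ℝ≥0} (hψ : ∀ k, LipschitzWith K (ψ k))
    (h0 : ∀ k, ∀ x ∉ C k, ψ k x = 0) :
    ∃ w : Euc N → Euc m, LipschitzWith (2 * K) w ∧ (∀ k, ∀ x ∈ C k, w x = ψ k x) ∧
      ∀ x ∉ ⋃ k, C k, w x = 0 := by
  classical
  let w : Euc N → Euc m := fun x => if h : ∃ k, x ∈ C k then ψ h.choose x else 0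
  have hw1 : ∀ k, ∀ x ∈ C k, w x = ψ k x := by
    intro k x hx
    have h : ∃ k, x ∈ C k := ⟨k, hx⟩
    have hk : h.choose = k := by
      by_contra hne
      exact (Set.disjoint_left.1 (hC hne)) h.choose_spec hx
    simp only [w, dif_pos h, hk]
  have hw2 : ∀ x ∉ ⋃ k, C k, w x = 0 := by
    intro x hx
    have h : ¬ ∃ k, x ∈ C k := by simpa using hx
    simp only [w, dif_neg h]
  refine ⟨w, ?_, hw1, hw2⟩
  have key : ∀ k, ∀ x ∈ C k, ∀ y, dist (w x) (w y) ≤ 2 * K * dist x y := by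
    intro k x hx y
    have hK : 0 ≤ (K : ℝ) * dist x y := by positivity
    by_cases hyk : y ∈ C k
    · rw [hw1 k x hx, hw1 k y hyk]
      have := (hψ k).dist_le_mul x y
      linarith
    · have h1 := (hψ k).dist_le_mul x y
      rw [h0 k y hyk] at h1
      by_cases hy : ∃ l, y ∈ C l
      · obtain ⟨l, hl⟩ := hy
        -- For points in different sets, `ψ k` vanishes at `y` and `ψ l` at `x`; the triangle
        -- inequality through `0` costs the factor 2.
        have hkl : k ≠ l := fun h => hyk (h ▸ hl)
        have h2 := (hψ l).dist_le_mul x y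
        rw [h0 l x (Set.disjoint_left.1 (hC hkl) hx)] at h2
        rw [hw1 k x hx, hw1 l y hl]
        have := dist_triangle (ψ k x) 0 (ψ l y)
        linarith
      · rw [hw1 k x hx, hw2 y (by simpa using hy)]
        linarith
  refine LipschitzWith.of_dist_le_mul fun x y => ?_
  push_cast
  by_cases hx : ∃ k, x ∈ C k
  · obtain ⟨k, hk⟩ := hx
    exact key k x hk y
  · by_cases hy : ∃ k, y ∈ C k
    · obtain ⟨k, hk⟩ := hy
      rw [dist_comm, dist_comm x]
      exact key k y hk x
    · rw [hw2 x (by simpa using hx), hw2 y (by simpa using hy), dist_self]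
      positivity

/-! ### The unit cube and its rescalings -/

theorem isOpen_unitCube (N : ℕ) : IsOpen (unitCube N) := by
  have : unitCube N = ⋂ i, {x : Euc N | 0 < x i ∧ x i < 1} := by
    ext x; simp [unitCube]
  rw [this]
  refine isOpen_iInter_of_finite fun i => ?_
  have hc : Continuous fun x : Euc N => x i := (EuclideanSpace.proj (𝕜 := ℝ) i).continuous
  exact (isOpen_lt continuous_const hc).inter (isOpen_lt hc continuous_const)

theorem convex_unitCube (N : ℕ) : Convex ℝ (unitCube N) := by
  intro x hx y hy a b ha hb hab i
  obtain ⟨h1, h2⟩ := hx i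
  obtain ⟨h3, h4⟩ := hy i
  simp only [PiLp.add_apply, PiLp.smul_apply, smul_eq_mul]
  rcases ha.eq_or_lt with rfl | ha'
  · have : b = 1 := by linarith
    subst this
    constructor <;> linarith
  · constructor
    · have := mul_pos ha' h1
      have := mul_nonneg hb h3.le
      linarith
    · have := mul_lt_mul_of_pos_left h2 ha'
      have := mul_le_mul_of_nonneg_left h4.le hb
      linarith

theorem volume_frontier_unitCube (N : ℕ) : volume (frontier (unitCube N)) = 0 :=
  (convex_unitCube N).addHaar_frontier volume

theorem volume_coordinate_box (I : Fin N → Set ℝ) (hI : ∀ i, MeasurableSet (I i)) :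
    volume {x : Euc N | ∀ i, x i ∈ I i} = ∏ i, volume (I i) := by
  have h := (PiLp.volume_preserving_ofLp (Fin N)).measure_preimage
    (MeasurableSet.univ_pi hI).nullMeasurableSet
  rw [volume_pi_pi] at h
  rw [← h]
  congr 1
  ext x
  simp

theorem volume_unitCube (N : ℕ) : volume (unitCube N) = 1 := by
  have h := volume_coordinate_box (N := N) (fun _ => Ioo 0 1) fun _ => measurableSet_Ioo
  simp only [Real.volume_Ioo, sub_zero, ENNReal.ofReal_one, Finset.prod_const_one] at h
  exact h

theorem norm_le_sum_abs (v : Euc N) : ‖v‖ ≤ ∑ i, |v i| := by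
  rw [EuclideanSpace.norm_eq, Real.sqrt_le_iff]
  refine ⟨Finset.sum_nonneg fun _ _ => abs_nonneg _, ?_⟩
  have := Finset.sum_sq_le_sq_sum_of_nonneg (s := Finset.univ) (f := fun i => |v i|)
    fun i _ => abs_nonneg (v i)
  simpa using this

/-- The map sending the cube with corner `a` and side `r` to the unit cube. -/
noncomputable def toUnit (a : Euc N) (r : ℝ) (x : Euc N) : Euc N := r⁻¹ • (x - a)

theorem continuous_toUnit (a : Euc N) (r : ℝ) : Continuous (toUnit a r) := by
  unfold toUnit; fun_prop

theorem map_toUnit (a : Euc N) {r : ℝ} (hr : 0 < r) :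
    Measure.map (toUnit a r) volume = ENNReal.ofReal (r ^ N) • (volume : Measure (Euc N)) := by
  have h1 : toUnit a r = (fun x => r⁻¹ • x) ∘ fun x : Euc N => x - a := rfl
  rw [h1, ← Measure.map_map (by fun_prop) (by fun_prop), map_sub_right_eq_self,
    Measure.map_addHaar_smul volume (inv_ne_zero hr.ne')]
  congr 2
  rw [finrank_euclideanSpace_fin, inv_pow, inv_inv, abs_of_pos (by positivity)]

theorem measurableEmbedding_toUnit (a : Euc N) {r : ℝ} (hr : 0 < r) :
    MeasurableEmbedding (toUnit a r) := by
  have h1 : toUnit a r =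
      ((Homeomorph.addRight (-a)).trans (Homeomorph.smulOfNeZero r⁻¹ (inv_ne_zero hr.ne'))) := by
    ext x i
    simp [toUnit, sub_eq_add_neg]
  rw [h1]
  exact Homeomorph.measurableEmbedding _

/-- Since `toUnit a r` is a measurable embedding, the change of variables needs no measurability of
the set or the integrand; `Adm.exists_transplant` uses it with an arbitrary `H`. -/
theorem setLIntegral_comp_toUnit (a : Euc N) {r : ℝ} (hr : 0 < r) (s : Set (Euc N))
    (f : Euc N → ℝ≥0∞) :
    ∫⁻ x in toUnit a r ⁻¹' s, f (toUnit a r x) = ENNReal.ofReal (r ^ N) * ∫⁻ y in s, f y := by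
  have he := measurableEmbedding_toUnit a hr
  rw [← he.lintegral_map, ← he.restrict_map, map_toUnit a hr, Measure.restrict_smul,
    lintegral_smul_measure, smul_eq_mul]

theorem volume_preimage_toUnit (a : Euc N) {r : ℝ} (hr : 0 < r) (s : Set (Euc N)) :
    volume (toUnit a r ⁻¹' s) = ENNReal.ofReal (r ^ N) * volume s := by
  rw [← (measurableEmbedding_toUnit a hr).map_apply, map_toUnit a hr]
  rfl

theorem tendsto_toUnit_nhds_inf_ae (a : Euc N) {r : ℝ} (hr : 0 < r) (x : Euc N) :
    Tendsto (toUnit a r) (𝓝 x ⊓ ae volume) (𝓝 (toUnit a r x) ⊓ ae volume) := by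
  have h1 : Tendsto (toUnit a r) (𝓝 x) (𝓝 (toUnit a r x)) := (continuous_toUnit a r).tendsto x
  have h2 : Tendsto (toUnit a r) (ae volume) (ae (volume : Measure (Euc N))) := by
    intro s hs
    rw [mem_ae_iff] at hs
    rw [mem_map, mem_ae_iff, ← preimage_compl, volume_preimage_toUnit a hr, hs, mul_zero]
  exact h1.inf h2

/-- The open cube with corner `a` and side `r`. -/
def cube (a : Euc N) (r : ℝ) : Set (Euc N) := toUnit a r ⁻¹' unitCube N

theorem isOpen_cube (a : Euc N) (r : ℝ) : IsOpen (cube a r) :=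
  (isOpen_unitCube N).preimage (continuous_toUnit a r)

theorem convex_cube (a : Euc N) (r : ℝ) : Convex ℝ (cube a r) := by
  intro x hx y hy s t hs ht hst
  have h := convex_unitCube N hx hy hs ht hst
  have h2 : toUnit a r (s • x + t • y) = s • toUnit a r x + t • toUnit a r y := by
    have : a = s • a + t • a := by rw [← add_smul, hst, one_smul]
    simp only [toUnit]
    nth_rw 1 [this]
    module
  show toUnit a r (s • x + t • y) ∈ unitCube N
  rw [h2]; exact h

theorem mem_centered_cube {c x : Euc N} {s : ℝ} (hs : 0 < s) :
    x ∈ cube (c - WithLp.toLp 2 fun _ => s) (2 * s) ↔ ∀ i, |x i - c i| < s := by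
  simp only [cube, mem_preimage, toUnit, unitCube, mem_ofPred_eq]
  refine forall_congr' fun i => ?_
  simp only [PiLp.smul_apply, PiLp.sub_apply, smul_eq_mul]
  rw [abs_lt, inv_mul_eq_div, lt_div_iff₀ (by positivity), div_lt_iff₀ (by positivity)]
  constructor <;> rintro ⟨h1, h2⟩ <;> constructor <;> linarith

/-! ### Filling open sets by cubes and transplanting profiles -/

/-- An open set is, up to a null set, the disjoint union of countably many open cubes. -/
theorem exists_cube_filling {V : Set (Euc N)} (hV : IsOpen V) :
    ∃ (ι : Type) (_ : Countable ι) (a : ι → Euc N) (r : ι → ℝ), (∀ k, 0 < r k) ∧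
      (∀ k, cube (a k) (r k) ⊆ V) ∧
      Pairwise (Function.onFun Disjoint fun k => cube (a k) (r k)) ∧
      volume (V \ ⋃ k, cube (a k) (r k)) = 0 := by
  let B : Euc N × ℝ → Set (Euc N) := fun p => cube (p.1 - WithLp.toLp 2 fun _ => p.2) (2 * p.2)
  let t : Set (Euc N × ℝ) := {p | 0 < p.2 ∧ closure (B p) ⊆ V}
  have hball : ∀ p ∈ t, Metric.ball p.1 p.2 ⊆ B p := by
    rintro p ⟨hp, -⟩ x hx
    rw [mem_centered_cube hp]
    intro i
    rw [mem_ball_iff_norm] at hx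
    exact lt_of_le_of_lt (PiLp.norm_apply_le (x - p.1) i) hx
  have hsub : ∀ p : Euc N × ℝ, 0 < p.2 → B p ⊆ Metric.closedBall p.1 ((N + 1) * p.2) := by
    rintro p hp x hx
    rw [mem_centered_cube hp] at hx
    rw [mem_closedBall_iff_norm]
    calc ‖x - p.1‖ ≤ ∑ i, |(x - p.1) i| := norm_le_sum_abs _
      _ ≤ ∑ _i : Fin N, p.2 := Finset.sum_le_sum fun i _ => (hx i).le
      _ ≤ (N + 1) * p.2 := by
        simp only [Finset.sum_const, Finset.card_univ, Fintype.card_fin, nsmul_eq_mul]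
        nlinarith
  have hcl : ∀ p : Euc N × ℝ, 0 < p.2 →
      closure (B p) ⊆ Metric.closedBall p.1 ((N + 1) * p.2) := fun p hp =>
    closure_minimal (hsub p hp) Metric.isClosed_closedBall
  -- A cube of half-side `s` contains the ball of radius `s` and lies in the closed ball of radius
  -- `(N + 1) s`. Tripling the latter radius gives the volume ratio `(3 (N + 1)) ^ N`, the constant
  -- in Vitali's theorem.
  obtain ⟨u, hut, huc, hud, hun⟩ := Vitali.exists_disjoint_covering_ae (volume : Measure (Euc N)) V t
    (Real.toNNReal ((3 * (N + 1)) ^ N)) (fun p => (N + 1) * p.2) (fun p => p.1)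
    (fun p => closure (B p)) (fun p hp => hcl p hp.1)
    (by
      intro p hp
      have hp1 := hp.1
      have h2 : volume (Metric.ball p.1 p.2) ≤ volume (closure (B p)) :=
        measure_mono ((hball p hp).trans subset_closure)
      refine le_trans (le_of_eq ?_) (mul_le_mul' le_rfl h2)
      rw [Measure.addHaar_closedBall volume _ (by positivity),
        Measure.addHaar_ball_of_pos volume _ hp1, finrank_euclideanSpace_fin, ← mul_assoc,
        ← mul_assoc, mul_pow, ENNReal.ofReal_mul (by positivity)]
      rfl)
    (by
      intro p hp
      refine ⟨p.1, interior_mono ((hball p hp).trans subset_closure) ?_⟩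
      rw [Metric.isOpen_ball.interior_eq]
      exact Metric.mem_ball_self hp.1)
    (fun p _ => isClosed_closure)
    (by
      intro x hx ε hε
      obtain ⟨δ, hδ, hδV⟩ := Metric.isOpen_iff.1 hV x hx
      have hN : (0 : ℝ) < N + 1 := by positivity
      refine ⟨(x, min ε (δ / 2) / (N + 1)), ⟨by positivity, ?_⟩, ?_, rfl⟩
      · refine (hcl _ (by positivity)).trans (Subset.trans ?_ hδV)
        refine Metric.closedBall_subset_ball ?_
        rw [mul_div_cancel₀ _ hN.ne']
        have := min_le_right ε (δ / 2)
        linarith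
      · show (N + 1) * (min ε (δ / 2) / (N + 1)) ≤ ε
        rw [mul_div_cancel₀ _ hN.ne']
        exact min_le_left _ _)
  have hcount : Countable u := huc.to_subtype
  refine ⟨u, hcount, fun p => p.1.1 - WithLp.toLp 2 fun _ => p.1.2, fun p => 2 * p.1.2,
    ?_, ?_, ?_, ?_⟩
  · intro p
    have := (hut p.2).1
    positivity
  · exact fun p => subset_closure.trans (hut p.2).2
  · intro p q hpq
    exact (hud p.2 q.2 fun h => hpq (Subtype.ext h)).mono subset_closure subset_closure
  -- The covering is by closed cubes; passing to open ones loses only the frontiers, null by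
  -- convexity.
  · have hfr : volume (⋃ p ∈ u, frontier (B p)) = 0 :=
      (measure_biUnion_null_iff huc).2 fun p _ => (convex_cube _ _).addHaar_frontier volume
    refine measure_mono_null ?_ (measure_union_null hun hfr)
    rintro x ⟨hxV, hx⟩
    by_cases h : x ∈ ⋃ p ∈ u, closure (B p)
    · right
      simp only [mem_iUnion] at h ⊢
      obtain ⟨p, hp, hxp⟩ := h
      refine ⟨p, hp, hxp, ?_⟩
      rw [(isOpen_cube _ _).interior_eq]
      exact fun hxB => hx (mem_iUnion.2 ⟨⟨p, hp⟩, hxB⟩)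
    · exact Or.inl ⟨hxV, h⟩

theorem toUnit_lipschitz_rescale {ψ : Euc N → Euc m} {K : ℝ≥0} (h : LipschitzWith K ψ) (a : Euc N)
    {r : ℝ} (hr : 0 < r) : LipschitzWith K fun x => r • ψ (toUnit a r x) := by
  refine LipschitzWith.of_dist_le_mul fun x y => ?_
  have h1 := h.dist_le_mul (toUnit a r x) (toUnit a r y)
  have h2 : dist (toUnit a r x) (toUnit a r y) = r⁻¹ * dist x y := by
    simp only [toUnit, dist_smul₀, dist_sub_right, norm_inv, Real.norm_eq_abs, abs_of_pos hr]
  rw [dist_smul₀, Real.norm_eq_abs, abs_of_pos hr]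
  calc r * dist (ψ (toUnit a r x)) (ψ (toUnit a r y)) ≤ r * (K * (r⁻¹ * dist x y)) := by
        rw [← h2]; gcongr
    _ = K * dist x y := by field_simp

/-- Any admissible function on the unit cube can be transplanted, by filling with rescaled copies,
to any open set, without changing the distribution of its gradient. -/
theorem Adm.exists_transplant {b : Prop} {ψ : Euc N → Euc m} (hψ : Adm b (unitCube N) ψ)
    {V : Set (Euc N)} (hV : IsOpen V) :
    ∃ w : Euc N → Euc m, Adm b V w ∧ ∀ H : Mat m N → ℝ≥0∞,
      ∫⁻ x in V, H (gradMat w x) = volume V * ∫⁻ y in unitCube N, H (gradMat ψ y) := by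
  obtain ⟨ι, hι, a, r, hr, hsub, hdisj, hnull⟩ := exists_cube_filling hV
  obtain ⟨K, hK⟩ := hψ.lipschitz
  obtain ⟨w, hw, hw1, hw2⟩ := exists_lipschitz_glue hdisj
    (fun k => toUnit_lipschitz_rescale hK (a k) (hr k)) (fun k x hx => by
      rw [hψ.zero_off _ hx, smul_zero])
  have hgrad : ∀ k, ∀ x ∈ cube (a k) (r k), gradMat w x = gradMat ψ (toUnit (a k) (r k) x) := by
    intro k x hx
    rw [gradMat_congr (v := fun x => r k • ψ (toUnit (a k) (r k) x))]
    · exact gradMat_rescale ψ (a k) x (hr k).ne'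
    · filter_upwards [(isOpen_cube (a k) (r k)).mem_nhds hx] with y hy using hw1 k y hy
  have hae : V =ᵐ[volume] ⋃ k, cube (a k) (r k) := by
    refine Filter.EventuallyLE.antisymm (ae_le_set.2 hnull) ?_
    exact (iUnion_subset hsub).eventuallyLE
  refine ⟨w, ⟨⟨_, hw⟩, ?_, ?_⟩, ?_⟩
  · exact fun x hx => hw2 x fun h => hx (iUnion_subset hsub h)
  · intro hb
    obtain ⟨S, hS, hSae⟩ := hψ.fin_grad hb
    refine ⟨S, hS, ?_⟩
    rw [Measure.restrict_congr_set hae, ae_restrict_iUnion_iff]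
    intro k
    rw [ae_restrict_iff' (isOpen_unitCube N).measurableSet, ae_iff] at hSae
    rw [ae_restrict_iff' (isOpen_cube _ _).measurableSet, ae_iff]
    have h0 := volume_preimage_toUnit (a k) (hr k) _ ▸
      congrArg (fun t => ENNReal.ofReal (r k ^ N) * t) hSae
    rw [mul_zero] at h0
    refine measure_mono_null ?_ h0
    intro x hx hx'
    refine hx fun hxc => ?_
    obtain ⟨A, hA, hev⟩ := hx' hxc
    refine ⟨A, hA, ?_⟩
    have h1 := (tendsto_toUnit_nhds_inf_ae (a k) (hr k) x).eventually hev
    have h2 : ∀ᶠ y in 𝓝 x ⊓ ae (volume : Measure (Euc N)), y ∈ cube (a k) (r k) :=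
      Filter.Eventually.filter_mono inf_le_left ((isOpen_cube _ _).mem_nhds hxc)
    filter_upwards [h1, h2] with y hy1 hy2
    rw [hgrad k y hy2, hy1]
  · intro H
    rw [setLIntegral_congr hae, measure_congr hae,
      lintegral_iUnion (fun k => (isOpen_cube _ _).measurableSet) hdisj,
      measure_iUnion hdisj (fun k => (isOpen_cube _ _).measurableSet), ← ENNReal.tsum_mul_right]
    refine tsum_congr fun k => ?_
    rw [setLIntegral_congr_fun (isOpen_cube _ _).measurableSet
      (fun x hx => congrArg H (hgrad k x hx) :
        EqOn (fun x => H (gradMat w x)) (fun x => H (gradMat ψ (toUnit (a k) (r k) x))) _)]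
    unfold cube
    rw [setLIntegral_comp_toUnit (a k) (hr k) _ fun y => H (gradMat ψ y),
      volume_preimage_toUnit _ (hr k), volume_unitCube, mul_one]

/-! ### Jensen's inequality for finitely many gradients -/

/-- The infimum of `∫_Y W (F + ∇φ)` over the admissible functions. -/
noncomputable def relaxZ (b : Prop) (W : Mat m N → ℝ≥0∞) (F : Mat m N) : ℝ≥0∞ :=
  ⨅ (u : Euc N → Euc m) (_ : Adm b (unitCube N) u), ∫⁻ y in unitCube N, W (F + gradMat u y)

theorem relaxZ_le {b : Prop} {W : Mat m N → ℝ≥0∞} {F : Mat m N} {u : Euc N → Euc m}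
    (hu : Adm b (unitCube N) u) : relaxZ b W F ≤ ∫⁻ y in unitCube N, W (F + gradMat u y) :=
  iInf₂_le u hu

theorem exists_lt_of_relaxZ_ne_top {b : Prop} {W : Mat m N → ℝ≥0∞} {F : Mat m N}
    (h : relaxZ b W F ≠ ⊤) {ε : ℝ≥0∞} (hε : ε ≠ 0) : ∃ u, Adm b (unitCube N) u ∧
      ∫⁻ y in unitCube N, W (F + gradMat u y) ≤ relaxZ b W F + ε := by
  have h1 : relaxZ b W F < relaxZ b W F + ε := ENNReal.lt_add_right h hε
  obtain ⟨u, hu⟩ := iInf_lt_iff.1 h1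
  obtain ⟨hu', hlt⟩ := iInf_lt_iff.1 hu
  exact ⟨u, hu', hlt.le⟩

theorem exists_lipschitz_sum {ι : Type*} (s : Finset ι) {w : ι → Euc N → Euc m}
    (h : ∀ i ∈ s, ∃ K, LipschitzWith K (w i)) :
    ∃ K, LipschitzWith K fun x => ∑ i ∈ s, w i x := by
  classical
  induction s using Finset.induction_on with
  | empty => exact ⟨0, by simp [LipschitzWith.const (0 : Euc m)]⟩
  | insert i s hi ih =>
    obtain ⟨K, hK⟩ := ih fun j hj => h j (Finset.mem_insert_of_mem hj)
    obtain ⟨L, hL⟩ := h i (Finset.mem_insert_self i s)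
    refine ⟨L + K, ?_⟩
    simp only [Finset.sum_insert hi]
    exact hL.add hK

/-- Jensen's inequality for the relaxed density along functions with finitely many gradients. -/
theorem relaxZ_le_lintegral_relaxZ {b : Prop} {W : Mat m N → ℝ≥0∞}
    (hfin : ∀ F, relaxZ b W F ≠ ⊤) (F : Mat m N) {u : Euc N → Euc m}
    (hu : Adm True (unitCube N) u) :
    relaxZ b W F ≤ ∫⁻ y in unitCube N, relaxZ b W (F + gradMat u y) := by
  classical
  refine ENNReal.le_of_forall_pos_le_add fun ε hε _ => ?_
  obtain ⟨S₀, hS₀, hSae⟩ := hu.fin_grad trivial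
  obtain ⟨S, rfl⟩ := hS₀.exists_finset_coe
  let R : Mat m N → Set (Euc N) := fun A => gradRegion u A ∩ unitCube N
  have hRo : ∀ A, IsOpen (R A) := fun A => (isOpen_gradRegion u A).inter (isOpen_unitCube N)
  have hRd : ∀ A B, A ≠ B → Disjoint (R A) (R B) := fun A B h =>
    (disjoint_gradRegion u h).mono inter_subset_left inter_subset_left
  have hRY : unitCube N =ᵐ[volume] ⋃ A ∈ S, R A := by
    refine Filter.EventuallyLE.antisymm ?_ ?_
    · rw [ae_restrict_iff' (isOpen_unitCube N).measurableSet] at hSae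
      filter_upwards [hSae] with x hx hxY
      obtain ⟨A, hA, hev⟩ := hx hxY
      exact mem_biUnion (show A ∈ S from hA) ⟨hev, hxY⟩
    · exact (iUnion₂_subset fun A _ => inter_subset_right).eventuallyLE
  have hsplit : ∀ f : Euc N → ℝ≥0∞, ∫⁻ y in unitCube N, f y = ∑ A ∈ S, ∫⁻ y in R A, f y := by
    intro f
    rw [setLIntegral_congr hRY]
    exact lintegral_biUnion_finset (fun A _ B _ h => hRd A B h)
      (fun A _ => (hRo A).measurableSet) f
  have hψ : ∀ A : Mat m N, ∃ ψ, Adm b (unitCube N) ψ ∧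
      ∫⁻ y in unitCube N, W (F + A + gradMat ψ y) ≤ relaxZ b W (F + A) + ε := fun A =>
    exists_lt_of_relaxZ_ne_top (hfin _) (by exact_mod_cast hε.ne')
  choose ψ hψ hψle using hψ
  choose w hw hwint using fun A => (hψ A).exists_transplant (hRo A)
  -- On `R A` only the summand `w A` survives, so there the gradient of `v` is that of the
  -- near-minimiser shifted by `A`.
  let v : Euc N → Euc m := fun x => u x + ∑ A ∈ S, w A x
  have hudiff : ∀ᵐ x ∂(volume : Measure (Euc N)), DifferentiableAt ℝ u x := by
    obtain ⟨K, hK⟩ := hu.lipschitz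
    exact hK.ae_differentiableAt
  have hwdiff : ∀ A, ∀ᵐ x ∂(volume : Measure (Euc N)), DifferentiableAt ℝ (w A) x := by
    intro A
    obtain ⟨K, hK⟩ := (hw A).lipschitz
    exact hK.ae_differentiableAt
  have hgrad : ∀ A ∈ S, ∀ᵐ x ∂(volume.restrict (R A)),
      gradMat v x = A + gradMat (w A) x := by
    intro A hA
    have h1 : ∀ᵐ x ∂(volume.restrict (R A)), gradMat u x = A :=
      ae_restrict_of_ae_restrict_of_subset inter_subset_left (ae_gradRegion u A)
    filter_upwards [h1, ae_restrict_of_ae hudiff, ae_restrict_of_ae (hwdiff A),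
      ae_restrict_mem (hRo A).measurableSet] with x hx hux hwx hxR
    rw [← hx]
    nth_rw 2 [hx]
    rw [← gradMat_add hux hwx]
    refine gradMat_congr ?_
    filter_upwards [(hRo A).mem_nhds hxR] with y hy
    simp only [v]
    rw [Finset.sum_eq_single_of_mem A hA fun B _ hBA =>
      (hw B).zero_off y (Set.disjoint_left.1 (hRd A B hBA.symm) hy)]
  have hv : Adm b (unitCube N) v := by
    refine ⟨?_, ?_, ?_⟩
    · obtain ⟨K, hK⟩ := hu.lipschitz
      obtain ⟨L, hL⟩ := exists_lipschitz_sum S fun A _ => (hw A).lipschitz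
      exact ⟨_, hK.add hL⟩
    · intro x hx
      simp only [v]
      rw [hu.zero_off x hx, Finset.sum_eq_zero fun A _ => (hw A).zero_off x fun h => hx h.2,
        add_zero]
    -- The new gradients are sums `A + B`, with `A` from `u` and `B` from the profile inserted in `R
    -- A`; these are still finitely many.
    · intro hb
      choose T hT hTae using fun A => (hw A).fin_grad hb
      refine ⟨⋃ A ∈ S, (fun B => A + B) '' T A,
        S.finite_toSet.biUnion fun A _ => (hT A).image _, ?_⟩
      rw [Measure.restrict_congr_set hRY, ae_restrict_biUnion_finset_iff]
      intro A hA
      filter_upwards [hTae A, ae_restrict_mem (hRo A).measurableSet] with x hx hxR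
      obtain ⟨B, hB, hev⟩ := hx
      refine ⟨A + B, mem_biUnion (show A ∈ S from hA) ⟨B, hB, rfl⟩, ?_⟩
      filter_upwards [hev, eventually_nhds_inf_ae_of_isOpen (hRo A) hxR (hgrad A hA)] with y h1 h2
      rw [h2, h1]
  calc relaxZ b W F ≤ ∫⁻ y in unitCube N, W (F + gradMat v y) := relaxZ_le hv
    _ = ∑ A ∈ S, ∫⁻ y in R A, W (F + gradMat v y) := hsplit _
    _ = ∑ A ∈ S, volume (R A) * ∫⁻ y in unitCube N, W (F + A + gradMat (ψ A) y) := by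
        refine Finset.sum_congr rfl fun A hA => ?_
        rw [← hwint A fun B => W (F + A + B)]
        refine lintegral_congr_ae ?_
        filter_upwards [hgrad A hA] with x hx
        rw [hx, add_assoc]
    _ ≤ ∑ A ∈ S, volume (R A) * (relaxZ b W (F + A) + ε) :=
        Finset.sum_le_sum fun A _ => mul_le_mul' le_rfl (hψle A)
    _ = ∑ A ∈ S, ∫⁻ y in R A, (relaxZ b W (F + gradMat u y) + ε) := by
        refine Finset.sum_congr rfl fun A hA => ?_
        have h1 : ∀ᵐ x ∂(volume.restrict (R A)), gradMat u x = A :=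
          ae_restrict_of_ae_restrict_of_subset inter_subset_left (ae_gradRegion u A)
        rw [lintegral_congr_ae (g := fun _ => relaxZ b W (F + A) + ε)
          (by filter_upwards [h1] with x hx; rw [hx]), setLIntegral_const, mul_comm]
    _ = ∫⁻ y in unitCube N, (relaxZ b W (F + gradMat u y) + ε) := (hsplit _).symm
    _ = (∫⁻ y in unitCube N, relaxZ b W (F + gradMat u y)) + ε := by
        rw [lintegral_add_right _ measurable_const, setLIntegral_const, volume_unitCube, mul_one]

/-! ### Separately convex functions -/

/-- On `[-R, R]` a convex function of one variable is bounded by its larger endpoint value, so the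
coordinates can be pushed to `±R` one after another without decreasing `g`. As there are finitely
many vertices, this bounds `g` on boxes. -/
theorem exists_vertex_ge_of_separately_convex {ι : Type*} [DecidableEq ι] {g : (ι → ℝ) → ℝ}
    (hconv : ∀ x i, ConvexOn ℝ univ fun t => g (Function.update x i t)) (R : ℝ) (s : Finset ι) :
    ∀ x : ι → ℝ, (∀ i ∈ s, |x i| ≤ R) → ∃ y : ι → ℝ, (∀ i ∈ s, y i = R ∨ y i = -R) ∧
      (∀ i ∉ s, y i = x i) ∧ g x ≤ g y := by
  induction s using Finset.induction_on with
  | empty => exact fun x _ => ⟨x, by simp, by simp, le_rfl⟩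
  | insert i s hi ih =>
    intro x hx
    obtain ⟨y, hy1, hy2, hy3⟩ := ih x fun k hk => hx k (Finset.mem_insert_of_mem hk)
    have hyi : |y i| ≤ R := by rw [hy2 i hi]; exact hx i (Finset.mem_insert_self i s)
    rw [abs_le] at hyi
    have h := (hconv y i).le_max_of_mem_Icc (x := -R) (y := R) (z := y i) (mem_univ _)
      (mem_univ _) ⟨hyi.1, hyi.2⟩
    simp only [Function.update_eq_self] at h
    have hz : ∀ t, (t = R ∨ t = -R) → g y ≤ g (Function.update y i t) →
        ∃ z : ι → ℝ, (∀ k ∈ insert i s, z k = R ∨ z k = -R) ∧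
          (∀ k ∉ insert i s, z k = x k) ∧ g x ≤ g z := by
      intro t ht hle
      refine ⟨Function.update y i t, ?_, ?_, hy3.trans hle⟩
      · intro k hk
        by_cases hki : k = i
        · subst hki; simpa using ht
        · rw [Function.update_of_ne hki]
          exact hy1 k ((Finset.mem_insert.1 hk).resolve_left hki)
      · intro k hk
        rw [Finset.mem_insert, not_or] at hk
        rw [Function.update_of_ne hk.1]
        exact hy2 k hk.2
    rcases le_max_iff.1 h with h | h
    · exact hz (-R) (Or.inr rfl) h
    · exact hz R (Or.inl rfl) h

theorem exists_bound_of_separately_convex {ι : Type*} [Fintype ι] [DecidableEq ι] {g : (ι → ℝ) → ℝ}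
    (hconv : ∀ x i, ConvexOn ℝ univ fun t => g (Function.update x i t)) (R : ℝ) :
    ∃ M, ∀ x : ι → ℝ, (∀ i, |x i| ≤ R) → g x ≤ M := by
  have hfin : {y : ι → ℝ | ∀ i, y i ∈ ({R, -R} : Set ℝ)}.Finite := by
    have := Set.Finite.pi' (fun _ : ι => Set.toFinite ({R, -R} : Set ℝ))
    exact this
  obtain ⟨M, hM⟩ := (hfin.image g).bddAbove
  refine ⟨M, fun x hx => ?_⟩
  obtain ⟨y, hy, -, hle⟩ := exists_vertex_ge_of_separately_convex hconv R Finset.univ x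
    fun i _ => hx i
  exact hle.trans (hM ⟨y, fun i => hy i (Finset.mem_univ i), rfl⟩)

/-- A nonnegative finite function which is convex in each variable separately is continuous. -/
theorem continuous_of_separately_convex {ι : Type*} [Fintype ι] [DecidableEq ι] {g : (ι → ℝ) → ℝ}
    (h0 : ∀ x, 0 ≤ g x)
    (hconv : ∀ x i, ConvexOn ℝ univ fun t => g (Function.update x i t)) : Continuous g := by
  rw [continuous_iff_continuousAt]
  intro x₀
  set R : ℝ := ‖x₀‖ + 1
  obtain ⟨M, hM⟩ := exists_bound_of_separately_convex hconv (R + 1)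
  have hcoord : ∀ x : ι → ℝ, (∀ i, |x i| ≤ R + 1) → ∀ i, ∀ s t, |s| < R → |t| < R →
      |g (Function.update x i s) - g (Function.update x i t)| ≤ (2 * M / 1).toNNReal * |s - t| := by
    intro x hx i s t hs ht
    -- A convex function with values in `[0, M]` on the ball of radius `R + 1` is Lipschitz on the
    -- ball of radius `R`; the margin 1 is the denominator in `2 * M / 1`.
    have h := ((hconv x i).subset (subset_univ (Metric.ball 0 (R + 1)))
      (convex_ball _ _)).lipschitzOnWith_of_abs_le (M := M) one_pos (fun a ha => by
        rw [abs_of_nonneg (h0 _)]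
        refine hM _ fun k => ?_
        by_cases hk : k = i
        · subst hk
          rw [Real.dist_0_eq_abs] at ha
          simpa using ha.le
        · rw [Function.update_of_ne hk]; exact hx k)
    rw [add_sub_cancel_right] at h
    exact h.dist_le_mul s (by simpa using hs) t (by simpa using ht)
  set L : ℝ := ((2 * M / 1).toNNReal : ℝ)
  -- Change the coordinates of `x` into those of `y` one at a time and add the estimates `hcoord`.
  have key : ∀ s : Finset ι, ∀ x y : ι → ℝ, (∀ i, |x i| < R) → (∀ i, |y i| < R) →
      (∀ i ∉ s, x i = y i) → |g x - g y| ≤ L * ∑ i ∈ s, |x i - y i| := by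
    intro s
    induction s using Finset.induction_on with
    | empty =>
      intro x y _ _ h
      have : x = y := funext fun i => h i (by simp)
      simp [this]
    | insert i s hi ih =>
      intro x y hx hy h
      set z := Function.update x i (y i)
      have h1 := ih z y (fun k => by
        by_cases hk : k = i
        · subst hk; simpa [z] using hy k
        · simpa [z, Function.update_of_ne hk] using hx k) hy (fun k hk => by
        by_cases hki : k = i
        · subst hki; simp [z]
        · simp only [z, Function.update_of_ne hki]
          exact h k (by simp [hki, hk]))
      have h2 := hcoord x (fun k => (hx k).le.trans (by linarith)) i (x i) (y i) (hx i) (hy i)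
      rw [Function.update_eq_self] at h2
      have h3 : ∑ k ∈ s, |z k - y k| = ∑ k ∈ s, |x k - y k| := Finset.sum_congr rfl fun k hk => by
        have : k ≠ i := fun hki => hi (hki ▸ hk)
        simp [z, Function.update_of_ne this]
      rw [h3] at h1
      rw [Finset.sum_insert hi, mul_add]
      have h4 := abs_sub_le (g x) (g z) (g y)
      linarith
  have hx₀ : ∀ i, |x₀ i| < R := fun i => by
    have := norm_le_pi_norm x₀ i
    rw [Real.norm_eq_abs] at this
    linarith
  have hlim : Tendsto (fun x : ι → ℝ => L * ∑ i, |x i - x₀ i|) (𝓝 x₀) (𝓝 0) := by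
    have hc : Continuous fun x : ι → ℝ => L * ∑ i, |x i - x₀ i| := by fun_prop
    simpa using hc.tendsto x₀
  have hbox : ∀ᶠ x in 𝓝 x₀, ∀ i, |x i| < R := by
    rw [eventually_all]
    intro i
    exact ((continuous_apply i).abs.tendsto x₀).eventually (gt_mem_nhds (hx₀ i))
  rw [ContinuousAt, tendsto_iff_dist_tendsto_zero]
  refine squeeze_zero' (Eventually.of_forall fun _ => dist_nonneg) ?_ hlim
  filter_upwards [hbox] with x hx
  exact key Finset.univ x x₀ hx hx₀ fun i hi => absurd (Finset.mem_univ i) hi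

/-! ### Continuous selections of affine functions -/

theorem volume_affine_level_eq_zero {l : Euc N →L[ℝ] ℝ} (hl : l ≠ 0) (c : ℝ) :
    volume {x | l x = c} = 0 := by
  rcases eq_empty_or_nonempty {x | l x = c} with h | ⟨x₀, hx₀⟩
  · rw [h, measure_empty]
  · have h1 : {x | l x = c} = (fun x => x - x₀) ⁻¹' (LinearMap.ker l.toLinearMap : Set (Euc N)) := by
      ext x
      have h2 : l x₀ = c := hx₀
      simp [h2, sub_eq_zero]
    rw [h1, (measurePreserving_sub_right volume x₀).measure_preimage
      (Submodule.closed_of_finiteDimensional _).measurableSet.nullMeasurableSet]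
    refine Measure.addHaar_submodule volume _ fun h => hl ?_
    ext x
    have : x ∈ LinearMap.ker l.toLinearMap := h ▸ Submodule.mem_top
    simpa using this

/-- A continuous selection of finitely many affine functions is locally affine off a null set. -/
theorem ae_locally_affine {P : Set ((Euc N →L[ℝ] ℝ) × ℝ)} (hP : P.Finite) {f : Euc N → ℝ}
    (hf : Continuous f) (hsel : ∀ x, ∃ p ∈ P, f x = p.1 x + p.2) :
    ∀ᵐ x ∂(volume : Measure (Euc N)), ∃ p ∈ P, ∀ᶠ y in 𝓝 x, f y = p.1 y + p.2 := by
  have hnull : ∀ p ∈ P, ∀ q ∈ P, p ≠ q →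
      ∀ᵐ x ∂(volume : Measure (Euc N)), p.1 x + p.2 ≠ q.1 x + q.2 := by
    intro p _ q _ hpq
    simp only [ae_iff, not_not]
    by_cases h : p.1 = q.1
    · have h2 : p.2 ≠ q.2 := fun h2 => hpq (Prod.ext h h2)
      simp [h, h2]
    · refine measure_mono_null ?_ (volume_affine_level_eq_zero (sub_ne_zero.2 h) (q.2 - p.2))
      intro x hx
      have hx' : p.1 x + p.2 = q.1 x + q.2 := hx
      show (p.1 - q.1) x = q.2 - p.2
      rw [sub_apply]
      linarith
  have hall : ∀ᵐ x ∂(volume : Measure (Euc N)), ∀ p ∈ P, ∀ q ∈ P, p ≠ q →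
      p.1 x + p.2 ≠ q.1 x + q.2 := by
    rw [ae_ball_iff hP.countable]
    intro p hp
    rw [ae_ball_iff hP.countable]
    intro q hq
    by_cases hpq : p = q
    · exact Eventually.of_forall fun x h => absurd hpq h
    · filter_upwards [hnull p hp q hq hpq] with x hx _ using hx
  filter_upwards [hall] with x hx
  obtain ⟨p, hp, hpx⟩ := hsel x
  refine ⟨p, hp, ?_⟩
  -- At `x` the planes take distinct values, so by continuity `f` avoids every plane other than `p`
  -- nearby; the selection must then be `p`.
  have hne : ∀ᶠ y in 𝓝 x, ∀ q ∈ P, q ≠ p → f y ≠ q.1 y + q.2 := by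
    rw [eventually_all_finite hP]
    intro q hq
    by_cases hqp : q = p
    · exact Eventually.of_forall fun y h => absurd hqp h
    · have h1 : f x ≠ q.1 x + q.2 := by
        rw [hpx]; exact hx p hp q hq fun h => hqp h.symm
      have hc : Continuous fun y => q.1 y + q.2 := by fun_prop
      filter_upwards [(isOpen_ne_fun hf hc).mem_nhds h1] with y hy _ using hy
  filter_upwards [hne] with y hy
  obtain ⟨q, hq, hqy⟩ := hsel y
  by_cases hqp : q = p
  · rw [← hqp, hqy]
  · exact absurd hqy (hy q hq hqp)

/-- The matrix whose rows represent the given linear functionals. -/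
noncomputable def rowsMat (l : Fin m → Euc N →L[ℝ] ℝ) : Mat m N :=
  Matrix.of fun i j => l i (EuclideanSpace.single j 1)

theorem gradMat_of_hasFDerivAt {u : Euc N → Euc m} {x : Euc N} {l : Fin m → Euc N →L[ℝ] ℝ}
    (h : ∀ i, HasFDerivAt (fun y => u y i) (l i) x) : gradMat u x = rowsMat l := by
  have hd : DifferentiableAt ℝ u x := by
    rw [differentiableAt_euclidean]
    exact fun i => (h i).differentiableAt
  ext i j
  have h1 : HasFDerivAt (fun y => u y i) ((EuclideanSpace.proj (𝕜 := ℝ) i).comp (fderiv ℝ u x)) x :=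
    (EuclideanSpace.proj (𝕜 := ℝ) i).hasFDerivAt.comp x hd.hasFDerivAt
  rw [rowsMat, Matrix.of_apply, ← h1.unique (h i)]
  rfl

theorem gradMat_of_locally_affine {u : Euc N → Euc m} {x : Euc N}
    {p : Fin m → (Euc N →L[ℝ] ℝ) × ℝ} (h : ∀ i, ∀ᶠ y in 𝓝 x, u y i = (p i).1 y + (p i).2) :
    gradMat u x = rowsMat fun i => (p i).1 := by
  refine gradMat_of_hasFDerivAt fun i => ?_
  have h1 : HasFDerivAt (fun y => (p i).1 y + (p i).2) (p i).1 x :=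
    (p i).1.hasFDerivAt.add_const _
  exact h1.congr_of_eventuallyEq (h i)

/-- Functions whose components are continuous selections of finitely many affine functions. -/
theorem finGrad_of_selection {u : Euc N → Euc m} (hu : Continuous u)
    {P : Fin m → Set ((Euc N →L[ℝ] ℝ) × ℝ)} (hP : ∀ i, (P i).Finite)
    (hsel : ∀ i x, ∃ p ∈ P i, u x i = p.1 x + p.2) (D : Set (Euc N)) : FinGrad D u := by
  refine ⟨(fun p : Fin m → (Euc N →L[ℝ] ℝ) × ℝ => rowsMat fun i => (p i).1) ''
    {p | ∀ i, p i ∈ P i}, (Set.Finite.pi' hP).image _, ?_⟩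
  have h : ∀ᵐ x ∂(volume : Measure (Euc N)), ∀ i, ∃ p ∈ P i, ∀ᶠ y in 𝓝 x, u y i = p.1 y + p.2 :=
    ae_all_iff.2 fun i => ae_locally_affine (hP i)
      ((EuclideanSpace.proj (𝕜 := ℝ) i).continuous.comp hu) (hsel i)
  filter_upwards [ae_restrict_of_ae h] with x hx
  choose p hp hev using hx
  refine ⟨_, ⟨p, hp, rfl⟩, Filter.Eventually.filter_mono inf_le_left ?_⟩
  filter_upwards [eventually_all.2 fun i => (hev i).eventually_nhds] with y hy
  exact gradMat_of_locally_affine hy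

/-! ### Laminates -/

/-- The constraints defining the laminate profile: a tent of width `ε` in the direction `j`, and the
distance to the faces of the unit cube in the other directions. -/
noncomputable def lamCoord (j : Fin N) (ε μ : ℝ) (k : Fin N) (x : Euc N) : ℝ :=
  if k = j then min ((1 - μ) * x j) (μ * (ε - x j)) else min (x k) (1 - x k)

/-- The laminate profile. -/
noncomputable def lamFun (j : Fin N) (ε μ : ℝ) (x : Euc N) : ℝ :=
  max 0 (Finset.univ.inf' ⟨j, Finset.mem_univ j⟩ fun k => lamCoord j ε μ k x)

/-- The affine functions of which the laminate profile is a selection. -/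
noncomputable def lamPieces (j : Fin N) (ε μ : ℝ) : Set ((Euc N →L[ℝ] ℝ) × ℝ) :=
  {0, ((1 - μ) • EuclideanSpace.proj j, 0), ((-μ) • EuclideanSpace.proj j, μ * ε)} ∪
    ((range fun k => (EuclideanSpace.proj k, 0)) ∪ range fun k => (-EuclideanSpace.proj k, 1))

theorem lamPieces_finite (j : Fin N) (ε μ : ℝ) : (lamPieces j ε μ).Finite :=
  (Set.toFinite _).union ((Set.finite_range _).union (Set.finite_range _))

theorem lamFun_selection (j : Fin N) (ε μ : ℝ) (x : Euc N) :
    ∃ p ∈ lamPieces j ε μ, lamFun j ε μ x = p.1 x + p.2 := by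
  rcases max_choice 0 (Finset.univ.inf' ⟨j, Finset.mem_univ j⟩ fun k => lamCoord j ε μ k x) with h | h
  · exact ⟨0, by simp [lamPieces], by rw [lamFun, h]; simp⟩
  · obtain ⟨k, -, hk⟩ := Finset.exists_mem_eq_inf' ⟨j, Finset.mem_univ j⟩
      fun k => lamCoord j ε μ k x
    rw [lamFun, h, hk, lamCoord]
    split_ifs with hkj
    · rcases min_choice ((1 - μ) * x j) (μ * (ε - x j)) with h2 | h2
      · exact ⟨((1 - μ) • EuclideanSpace.proj j, 0), by simp [lamPieces], by rw [h2]; simp⟩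
      · exact ⟨((-μ) • EuclideanSpace.proj j, μ * ε), by simp [lamPieces], by rw [h2]; simp; ring⟩
    · rcases min_choice (x k) (1 - x k) with h2 | h2
      · exact ⟨(EuclideanSpace.proj k, 0), by simp [lamPieces], by rw [h2]; simp⟩
      · exact ⟨(-EuclideanSpace.proj k, 1), by simp [lamPieces], by rw [h2]; simp; ring⟩

theorem lipschitz_affine_coord {a c : ℝ} (ha : |a| ≤ 1) (k : Fin N) :
    LipschitzWith 1 fun x : Euc N => a * x k + c := by
  refine LipschitzWith.of_dist_le_mul fun x y => ?_
  have h1 : |x k - y k| ≤ ‖x - y‖ := PiLp.norm_apply_le (x - y) k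
  rw [Real.dist_eq, dist_eq_norm, NNReal.coe_one, one_mul]
  have h2 : a * x k + c - (a * y k + c) = a * (x k - y k) := by ring
  rw [h2, abs_mul]
  calc |a| * |x k - y k| ≤ 1 * |x k - y k| := by gcongr
    _ ≤ ‖x - y‖ := by rwa [one_mul]

theorem lipschitz_lamFun (j : Fin N) (ε : ℝ) {μ : ℝ} (h0 : 0 ≤ μ) (h1 : μ ≤ 1) :
    LipschitzWith 1 (lamFun j ε μ) := by
  have hmin : ∀ f g : Euc N → ℝ, LipschitzWith 1 f → LipschitzWith 1 g →
      LipschitzWith 1 fun x => min (f x) (g x) := fun f g hf hg => by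
    simpa using hf.min hg
  have hk : ∀ k, LipschitzWith 1 (lamCoord j ε μ k) := by
    intro k
    by_cases hkj : k = j
    · have h2 : lamCoord j ε μ k =
          fun x => min ((1 - μ) * x j + 0) (-μ * x j + μ * ε) := by
        funext x
        simp only [lamCoord, if_pos hkj]
        congr 1 <;> ring
      rw [h2]
      exact hmin _ _ (lipschitz_affine_coord (by rw [abs_le]; constructor <;> linarith) j)
        (lipschitz_affine_coord (by rw [abs_le]; constructor <;> linarith) j)
    · have h2 : lamCoord j ε μ k = fun x => min (1 * x k + 0) (-1 * x k + 1) := by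
        funext x
        simp only [lamCoord, if_neg hkj]
        congr 1 <;> ring
      rw [h2]
      exact hmin _ _ (lipschitz_affine_coord (by simp) k) (lipschitz_affine_coord (by simp) k)
  have hinf : LipschitzWith 1 (Finset.univ.inf' ⟨j, Finset.mem_univ j⟩ fun k => lamCoord j ε μ k) :=
    Finset.inf'_induction ⟨j, Finset.mem_univ j⟩ _ (p := LipschitzWith 1)
      (fun f hf g hg => hmin f g hf hg) fun k _ => hk k
  have h3 : lamFun j ε μ = fun x => max 0
      ((Finset.univ.inf' ⟨j, Finset.mem_univ j⟩ fun k => lamCoord j ε μ k) x) := by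
    funext x
    exact congrArg (max 0) (Finset.inf'_apply ⟨j, Finset.mem_univ j⟩ (fun k => lamCoord j ε μ k) x).symm
  rw [h3]
  simpa using (LipschitzWith.const (0 : ℝ)).max hinf

theorem lamFun_eq_zero_of_le {j : Fin N} {ε μ : ℝ} {x : Euc N} (k : Fin N)
    (h : lamCoord j ε μ k x ≤ 0) : lamFun j ε μ x = 0 :=
  max_eq_left ((Finset.inf'_le _ (Finset.mem_univ k)).trans h)

theorem lamFun_eq_zero_of_lt {j : Fin N} {ε μ : ℝ} (h0 : 0 ≤ μ) {x : Euc N} (h : ε < x j) :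
    lamFun j ε μ x = 0 := by
  refine lamFun_eq_zero_of_le j ?_
  rw [lamCoord, if_pos rfl]
  exact (min_le_right _ _).trans (mul_nonpos_of_nonneg_of_nonpos h0 (by linarith))

theorem lamFun_eq_zero_of_notMem {j : Fin N} {ε μ : ℝ} (h0 : 0 ≤ μ) (h1 : μ ≤ 1) (hε : ε ≤ 1)
    {x : Euc N} (h : x ∉ unitCube N) : lamFun j ε μ x = 0 := by
  have h2 : ∃ k, ¬(0 < x k ∧ x k < 1) := by
    by_contra hc
    push Not at hc
    exact h fun i => hc i
  obtain ⟨k, hk⟩ := h2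
  refine lamFun_eq_zero_of_le k ?_
  rw [lamCoord]
  split_ifs with hkj
  · subst hkj
    by_cases h3 : 0 < x k
    · have h4 : 1 ≤ x k := not_lt.1 fun h4 => hk ⟨h3, h4⟩
      exact (min_le_right _ _).trans (mul_nonpos_of_nonneg_of_nonpos h0 (by linarith))
    · exact (min_le_left _ _).trans (mul_nonpos_of_nonneg_of_nonpos (by linarith) (not_lt.1 h3))
  · by_cases h3 : 0 < x k
    · have h4 : 1 ≤ x k := not_lt.1 fun h4 => hk ⟨h3, h4⟩
      exact (min_le_right _ _).trans (by linarith)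
    · exact (min_le_left _ _).trans (not_lt.1 h3)

/-- Here the tent is at most `ε` while the distances to the other faces are at least `ε`, so the
tent is the active constraint. -/
theorem lamFun_eq_tent {j : Fin N} {ε μ : ℝ} (h0 : 0 ≤ μ) (h1 : μ ≤ 1) {x : Euc N}
    (hx : 0 ≤ x j) (hxε : x j ≤ ε) (hlayer : ∀ k ≠ j, ε ≤ x k ∧ x k ≤ 1 - ε) :
    lamFun j ε μ x = min ((1 - μ) * x j) (μ * (ε - x j)) := by
  have h2 : 0 ≤ min ((1 - μ) * x j) (μ * (ε - x j)) :=
    le_min (mul_nonneg (by linarith) hx) (mul_nonneg h0 (by linarith))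
  have h3 : (Finset.univ.inf' ⟨j, Finset.mem_univ j⟩ fun k => lamCoord j ε μ k x)
      = min ((1 - μ) * x j) (μ * (ε - x j)) := by
    refine le_antisymm ?_ (Finset.le_inf' _ _ fun k _ => ?_)
    · refine (Finset.inf'_le _ (Finset.mem_univ j)).trans ?_
      rw [lamCoord, if_pos rfl]
    · rw [lamCoord]
      split_ifs with hkj
      · exact le_rfl
      · obtain ⟨h4, h5⟩ := hlayer k hkj
        refine (min_le_left _ _).trans ?_
        have : (1 - μ) * x j ≤ x j := by nlinarith
        exact le_min (by linarith) (by linarith)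
  rw [lamFun, h3, max_eq_right h2]

/-- The laminate in the direction of the `(i, j)` entry. -/
noncomputable def laminate (i : Fin m) (j : Fin N) (t ε μ : ℝ) (x : Euc N) : Euc m :=
  EuclideanSpace.single i (t * lamFun j ε μ x)

theorem laminate_lipschitz (i : Fin m) (j : Fin N) (t ε : ℝ) {μ : ℝ} (h0 : 0 ≤ μ) (h1 : μ ≤ 1) :
    LipschitzWith (Real.nnabs t) (laminate i j t ε μ) := by
  refine LipschitzWith.of_dist_le_mul fun x y => ?_
  have h := (lipschitz_lamFun j ε h0 h1).dist_le_mul x y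
  rw [laminate, laminate, PiLp.dist_single_same, Real.dist_eq, ← mul_sub, abs_mul]
  rw [Real.dist_eq, NNReal.coe_one, one_mul] at h
  rw [Real.coe_nnabs]
  gcongr

/-- The gradient of a function with only the `i`-th component nonzero. -/
noncomputable def rowMat (i : Fin m) (l : Euc N →L[ℝ] ℝ) : Mat m N :=
  rowsMat fun a => if a = i then l else 0

theorem laminate_apply (i a : Fin m) (j : Fin N) (t ε μ : ℝ) (x : Euc N) :
    laminate i j t ε μ x a = if a = i then t * lamFun j ε μ x else 0 := by
  simp [laminate, PiLp.single_apply]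

theorem gradMat_laminate {i : Fin m} {j : Fin N} {t ε μ : ℝ} {x : Euc N}
    {p : (Euc N →L[ℝ] ℝ) × ℝ} (h : ∀ᶠ y in 𝓝 x, lamFun j ε μ y = p.1 y + p.2) :
    gradMat (laminate i j t ε μ) x = rowMat i (t • p.1) := by
  have h1 := gradMat_of_locally_affine (u := laminate i j t ε μ) (x := x)
    (p := fun a => if a = i then (t • p.1, t * p.2) else 0) (by
      intro a
      filter_upwards [h] with y hy
      rw [laminate_apply]
      split_ifs
      · rw [hy]; simp; ring
      · simp)
  rw [h1, rowMat]
  congr 1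
  funext a
  split_ifs <;> rfl

theorem adm_laminate (i : Fin m) (j : Fin N) (t : ℝ) {ε μ : ℝ} (h0 : 0 ≤ μ) (h1 : μ ≤ 1)
    (hε : ε ≤ 1) : Adm True (unitCube N) (laminate i j t ε μ) := by
  have hlip := laminate_lipschitz i j t ε h0 h1
  refine ⟨⟨_, hlip⟩, ?_, fun _ => ?_⟩
  · intro x hx
    rw [laminate, lamFun_eq_zero_of_notMem h0 h1 hε hx]
    simp
  · refine finGrad_of_selection hlip.continuous (P := fun a => (fun p => if a = i then t • p else 0) ''
      lamPieces j ε μ) (fun a => (lamPieces_finite j ε μ).image _) ?_ _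
    intro a x
    obtain ⟨p, hp, hpx⟩ := lamFun_selection j ε μ x
    refine ⟨_, ⟨p, hp, rfl⟩, ?_⟩
    rw [laminate_apply]
    by_cases hai : a = i
    · simp [hai, hpx]; ring
    · simp [hai]

/-- The part of the unit cube lying in the slab `x j ∈ I`. -/
def slab (j : Fin N) (I : Set ℝ) : Set (Euc N) :=
  {x | ∀ i, x i ∈ if i = j then I else Ioo (0 : ℝ) 1}

theorem volume_slab (j : Fin N) {I : Set ℝ} (hI : MeasurableSet I) :
    volume (slab j I) = volume I := by
  rw [slab, volume_coordinate_box (fun i => if i = j then I else Ioo (0 : ℝ) 1)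
    (fun i => by split_ifs; exacts [hI, measurableSet_Ioo])]
  rw [Finset.prod_eq_single j]
  · simp
  · intro i _ hi; simp [hi]
  · simp

theorem measurableSet_slab (j : Fin N) {I : Set ℝ} (hI : MeasurableSet I) :
    MeasurableSet (slab j I) := by
  have h : slab j I = ⋂ i, (fun x : Euc N => x i) ⁻¹' (if i = j then I else Ioo (0 : ℝ) 1) := by
    ext x; simp only [slab, mem_ofPred_eq, mem_iInter, mem_preimage]
  rw [h]
  refine MeasurableSet.iInter fun i => ?_
  have hc : Measurable fun x : Euc N => x i := (EuclideanSpace.proj (𝕜 := ℝ) i).continuous.measurable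
  exact hc (by split_ifs; exacts [hI, measurableSet_Ioo])

theorem mem_slab {j : Fin N} {I : Set ℝ} {x : Euc N} (hx : x ∈ unitCube N) (hj : x j ∈ I) :
    x ∈ slab j I := by
  intro i
  split_ifs with h
  · exact h ▸ hj
  · exact hx i

theorem volume_coord_eq_zero (j : Fin N) (c : ℝ) : volume {x : Euc N | x j = c} = 0 := by
  have hne : (EuclideanSpace.proj j : Euc N →L[ℝ] ℝ) ≠ 0 := fun h => by
    have h1 := DFunLike.congr_fun h (EuclideanSpace.single j (1 : ℝ))
    simp at h1
  exact volume_affine_level_eq_zero hne c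

/-- The transition layer of the laminate near the faces `x k = 0` and `x k = 1`. -/
def layer (j k : Fin N) (ε : ℝ) : Set (Euc N) :=
  {x | ∀ i, x i ∈ if i = j then Ioo (0 : ℝ) ε else if i = k then Ioc 0 ε ∪ Ico (1 - ε) 1
    else Ioo (0 : ℝ) 1}

theorem measurableSet_layer (j k : Fin N) (ε : ℝ) : MeasurableSet (layer j k ε) := by
  have h : layer j k ε = ⋂ i, (fun x : Euc N => x i) ⁻¹'
      (if i = j then Ioo (0 : ℝ) ε else if i = k then Ioc 0 ε ∪ Ico (1 - ε) 1
        else Ioo (0 : ℝ) 1) := by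
    ext x; simp only [layer, mem_ofPred_eq, mem_iInter, mem_preimage]
  rw [h]
  refine MeasurableSet.iInter fun i => ?_
  have hc : Measurable fun x : Euc N => x i := (EuclideanSpace.proj (𝕜 := ℝ) i).continuous.measurable
  refine hc ?_
  split_ifs
  exacts [measurableSet_Ioo, measurableSet_Ioc.union measurableSet_Ico, measurableSet_Ioo]

theorem volume_layer_le {j k : Fin N} (hkj : k ≠ j) {ε : ℝ} (hε : 0 ≤ ε) :
    volume (layer j k ε) ≤ ENNReal.ofReal (2 * ε ^ 2) := by
  rw [layer, volume_coordinate_box (fun i => if i = j then Ioo (0 : ℝ) ε else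
    if i = k then Ioc 0 ε ∪ Ico (1 - ε) 1 else Ioo (0 : ℝ) 1) (fun i => by
      split_ifs
      exacts [measurableSet_Ioo, measurableSet_Ioc.union measurableSet_Ico, measurableSet_Ioo]),
    Finset.prod_eq_mul j k hkj.symm]
  · simp only [if_true, if_neg hkj, Real.volume_Ioo, sub_zero]
    have h1 : volume (Ioc 0 ε ∪ Ico (1 - ε) 1) ≤ ENNReal.ofReal (2 * ε) := by
      refine (measure_union_le _ _).trans ?_
      rw [Real.volume_Ioc, Real.volume_Ico, ← ENNReal.ofReal_add (by linarith) (by linarith)]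
      refine ENNReal.ofReal_le_ofReal (by linarith)
    refine (mul_le_mul' le_rfl h1).trans ?_
    rw [← ENNReal.ofReal_mul hε]
    exact ENNReal.ofReal_le_ofReal (by nlinarith)
  · intro i _ hi
    simp [hi.1, hi.2]
  · simp
  · simp

/-- The linear parts of the pieces of the laminate profile; they do not depend on its width. -/
noncomputable def lamSlopes (j : Fin N) (μ : ℝ) : Set (Euc N →L[ℝ] ℝ) :=
  {0, (1 - μ) • EuclideanSpace.proj j, (-μ) • EuclideanSpace.proj j} ∪
    ((range fun k => EuclideanSpace.proj k) ∪ range fun k => -EuclideanSpace.proj k)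

theorem lamSlopes_finite (j : Fin N) (μ : ℝ) : (lamSlopes j μ).Finite :=
  (Set.toFinite _).union ((Set.finite_range _).union (Set.finite_range _))

theorem fst_mem_lamSlopes {j : Fin N} {ε μ : ℝ} {p : (Euc N →L[ℝ] ℝ) × ℝ}
    (hp : p ∈ lamPieces j ε μ) : p.1 ∈ lamSlopes j μ := by
  rcases hp with (rfl | rfl | rfl) | ⟨k, rfl⟩ | ⟨k, rfl⟩
  · exact Or.inl (by simp)
  · exact Or.inl (by simp)
  · exact Or.inl (by simp)
  · exact Or.inr (Or.inl ⟨k, rfl⟩)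
  · exact Or.inr (Or.inr ⟨k, rfl⟩)

/-- The tent has slope `1 - μ` on a slab of thickness `μ ε`, slope `-μ` on one of thickness `(1 - μ)
ε`, and the profile vanishes beyond. What remains is within `ε` of a lateral face inside a slab of
width `ε`: at most `N` layers of volume at most `2 ε²`, where it is only known that the slope
belongs to the finite list `lamSlopes`. -/
theorem lintegral_laminate_le (i : Fin m) (j : Fin N) (t : ℝ) {ε μ : ℝ} (hμ0 : 0 < μ) (hμ1 : μ < 1)
    (hε0 : 0 < ε) (f : Mat m N → ℝ≥0∞) {M : ℝ≥0∞}
    (hM : ∀ l ∈ lamSlopes j μ, f (rowMat i (t • l)) ≤ M) :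
    ∫⁻ y in unitCube N, f (gradMat (laminate i j t ε μ) y) ≤
      ENNReal.ofReal (1 - ε) * f 0
        + ENNReal.ofReal (μ * ε) * f (rowMat i (t • ((1 - μ) • EuclideanSpace.proj j)))
        + ENNReal.ofReal ((1 - μ) * ε) * f (rowMat i (t • ((-μ) • EuclideanSpace.proj j)))
        + N * (ENNReal.ofReal (2 * ε ^ 2) * M) := by
  classical
  set z₁ := f (rowMat i (t • ((1 - μ) • EuclideanSpace.proj j)))
  set z₂ := f (rowMat i (t • ((-μ) • EuclideanSpace.proj j)))
  have hcont : ∀ k : Fin N, Continuous fun x : Euc N => x k := fun k =>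
    (EuclideanSpace.proj (𝕜 := ℝ) k).continuous
  have hae : ∀ᵐ x ∂(volume : Measure (Euc N)), x ∈ unitCube N →
      f (gradMat (laminate i j t ε μ) x) ≤
        (slab j (Ioo ε 1)).indicator (fun _ => f 0) x
        + (slab j (Ioo 0 (μ * ε))).indicator (fun _ => z₁) x
        + (slab j (Ioo (μ * ε) ε)).indicator (fun _ => z₂) x
        + ∑ k ∈ Finset.univ.filter (· ≠ j), (layer j k ε).indicator (fun _ => M) x := by
    have h1 : ∀ᵐ x ∂(volume : Measure (Euc N)), x j ≠ ε := by
      simpa [ae_iff] using volume_coord_eq_zero j ε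
    have h2 : ∀ᵐ x ∂(volume : Measure (Euc N)), x j ≠ μ * ε := by
      simpa [ae_iff] using volume_coord_eq_zero j (μ * ε)
    filter_upwards [h1, h2, ae_locally_affine (lamPieces_finite j ε μ)
      (lipschitz_lamFun j ε hμ0.le hμ1.le).continuous (lamFun_selection j ε μ)] with x hx1 hx2 hx3 hxY
    rcases lt_or_gt_of_ne hx1 with hlt | hgt
    · by_cases hlay : ∃ k, k ≠ j ∧ ¬ (ε < x k ∧ x k < 1 - ε)
      · obtain ⟨k, hkj, hk⟩ := hlay
        obtain ⟨p, hp, hpx⟩ := hx3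
        rw [gradMat_laminate hpx]
        have hxl : x ∈ layer j k ε := by
          intro a
          split_ifs with ha hak
          · subst ha; exact ⟨(hxY a).1, hlt⟩
          · subst hak
            by_cases h3 : x a ≤ ε
            · exact Or.inl ⟨(hxY a).1, h3⟩
            · exact Or.inr ⟨not_lt.1 fun h4 => hk ⟨not_le.1 h3, h4⟩, (hxY a).2⟩
          · exact hxY a
        refine (hM _ (fst_mem_lamSlopes hp)).trans (le_trans ?_ le_add_self)
        refine le_trans ?_ (Finset.single_le_sum (fun _ _ => zero_le)
          (Finset.mem_filter.2 ⟨Finset.mem_univ k, hkj⟩))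
        rw [indicator_of_mem hxl]
      · push Not at hlay
        have hnear : ∀ᶠ y in 𝓝 x, ∀ k, k ≠ j → ε ≤ y k ∧ y k ≤ 1 - ε := by
          rw [eventually_all]
          intro k
          by_cases hkj : k = j
          · exact Eventually.of_forall fun y h => absurd hkj h
          · filter_upwards [((hcont k).tendsto x).eventually (lt_mem_nhds (hlay k hkj).1),
              ((hcont k).tendsto x).eventually (gt_mem_nhds (hlay k hkj).2)] with y h3 h4 _
            exact ⟨h3.le, h4.le⟩
        have hj0 : ∀ᶠ y in 𝓝 x, 0 < y j := ((hcont j).tendsto x).eventually (lt_mem_nhds (hxY j).1)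
        have hjε : ∀ᶠ y in 𝓝 x, y j < ε := ((hcont j).tendsto x).eventually (gt_mem_nhds hlt)
        -- The two sides of the tent, `(1 - μ) x j` and `μ (ε - x j)`, meet at `x j = μ ε`.
        rcases lt_or_gt_of_ne hx2 with h3 | h3
        · have h4 : ∀ᶠ y in 𝓝 x, y j < μ * ε := ((hcont j).tendsto x).eventually (gt_mem_nhds h3)
          rw [gradMat_laminate (p := ((1 - μ) • EuclideanSpace.proj j, 0)) (by
            filter_upwards [hnear, hj0, hjε, h4] with y h5 h6 h7 h8
            rw [lamFun_eq_tent hμ0.le hμ1.le h6.le h7.le h5, min_eq_left (by nlinarith)]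
            simp)]
          rw [indicator_of_mem (mem_slab (I := Ioo 0 (μ * ε)) hxY ⟨(hxY j).1, h3⟩)]
          exact le_add_right (le_add_right le_add_self)
        · have h4 : ∀ᶠ y in 𝓝 x, μ * ε < y j := ((hcont j).tendsto x).eventually (lt_mem_nhds h3)
          rw [gradMat_laminate (p := ((-μ) • EuclideanSpace.proj j, μ * ε)) (by
            filter_upwards [hnear, hj0, hjε, h4] with y h5 h6 h7 h8
            rw [lamFun_eq_tent hμ0.le hμ1.le h6.le h7.le h5, min_eq_right (by nlinarith)]
            simp; ring)]
          rw [indicator_of_mem (mem_slab (I := Ioo (μ * ε) ε) hxY ⟨h3, hlt⟩)]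
          exact le_add_right le_add_self
    · have h3 : ∀ᶠ y in 𝓝 x, ε < y j := ((hcont j).tendsto x).eventually (lt_mem_nhds hgt)
      rw [gradMat_laminate (p := 0) (by
        filter_upwards [h3] with y hy
        rw [lamFun_eq_zero_of_lt hμ0.le hy]; simp)]
      rw [indicator_of_mem (mem_slab (I := Ioo ε 1) hxY ⟨hgt, (hxY j).2⟩)]
      have h4 : rowMat i (t • (0 : (Euc N →L[ℝ] ℝ) × ℝ).1) = (0 : Mat m N) := by
        ext a b; simp [rowMat, rowsMat]
      rw [h4]
      exact le_add_right (le_add_right (le_add_right le_rfl))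
  calc ∫⁻ y in unitCube N, f (gradMat (laminate i j t ε μ) y)
      ≤ ∫⁻ x in unitCube N, ((slab j (Ioo ε 1)).indicator (fun _ => f 0) x
        + (slab j (Ioo 0 (μ * ε))).indicator (fun _ => z₁) x
        + (slab j (Ioo (μ * ε) ε)).indicator (fun _ => z₂) x
        + ∑ k ∈ Finset.univ.filter (· ≠ j), (layer j k ε).indicator (fun _ => M) x) :=
        lintegral_mono_ae ((ae_restrict_iff' (isOpen_unitCube N).measurableSet).2 hae)
    _ ≤ ∫⁻ x, ((slab j (Ioo ε 1)).indicator (fun _ => f 0) x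
        + (slab j (Ioo 0 (μ * ε))).indicator (fun _ => z₁) x
        + (slab j (Ioo (μ * ε) ε)).indicator (fun _ => z₂) x
        + ∑ k ∈ Finset.univ.filter (· ≠ j), (layer j k ε).indicator (fun _ => M) x) :=
        setLIntegral_le_lintegral _ _
    _ = f 0 * volume (slab j (Ioo ε 1)) + z₁ * volume (slab j (Ioo 0 (μ * ε)))
        + z₂ * volume (slab j (Ioo (μ * ε) ε))
        + ∑ k ∈ Finset.univ.filter (· ≠ j), M * volume (layer j k ε) := by
        have hm1 : ∀ (I : Set ℝ) (c : ℝ≥0∞), MeasurableSet I →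
            Measurable ((slab j I).indicator fun _ : Euc N => c) := fun I c hI =>
          measurable_const.indicator (measurableSet_slab j hI)
        have hm2 : ∀ k, Measurable ((layer j k ε).indicator fun _ : Euc N => M) := fun k =>
          measurable_const.indicator (measurableSet_layer j k ε)
        rw [lintegral_add_right _ (Finset.measurable_fun_sum _ fun k _ => hm2 k),
          lintegral_add_right _ (hm1 _ _ measurableSet_Ioo),
          lintegral_add_right _ (hm1 _ _ measurableSet_Ioo),
          lintegral_finsetSum _ fun k _ => hm2 k,
          lintegral_indicator_const (measurableSet_slab j measurableSet_Ioo),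
          lintegral_indicator_const (measurableSet_slab j measurableSet_Ioo),
          lintegral_indicator_const (measurableSet_slab j measurableSet_Ioo)]
        congr 1
        exact Finset.sum_congr rfl fun k _ =>
          lintegral_indicator_const (measurableSet_layer j k ε) M
    _ ≤ _ := by
        rw [volume_slab j measurableSet_Ioo, volume_slab j measurableSet_Ioo,
          volume_slab j measurableSet_Ioo, Real.volume_Ioo, Real.volume_Ioo, Real.volume_Ioo,
          sub_zero]
        refine add_le_add (le_of_eq ?_) ?_
        · rw [mul_comm (f 0), mul_comm z₁, mul_comm z₂]
          congr 4
          ring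
        · calc ∑ k ∈ Finset.univ.filter (· ≠ j), M * volume (layer j k ε)
              ≤ ∑ k ∈ Finset.univ.filter (· ≠ j), ENNReal.ofReal (2 * ε ^ 2) * M := by
                refine Finset.sum_le_sum fun k hk => ?_
                rw [mul_comm]
                exact mul_le_mul' (volume_layer_le (Finset.mem_filter.1 hk).2 hε0.le) le_rfl
            _ ≤ ∑ _k : Fin N, ENNReal.ofReal (2 * ε ^ 2) * M :=
                Finset.sum_le_sum_of_subset (Finset.filter_subset _ _)
            _ = N * (ENNReal.ofReal (2 * ε ^ 2) * M) := by simp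

theorem rowMat_smul_proj (i : Fin m) (j : Fin N) (t c : ℝ) :
    rowMat i (t • (c • (EuclideanSpace.proj j : Euc N →L[ℝ] ℝ))) = Matrix.single i j (t * c) := by
  ext a b
  rw [rowMat, rowsMat, Matrix.of_apply, Matrix.single_apply]
  by_cases ha : a = i
  · by_cases hb : b = j
    · simp [ha, hb]
    · simp [ha, Ne.symm hb]
  · simp [ha, Ne.symm ha]

/-! ### Convexity in each entry and continuity of the relaxed density -/

/-- The relaxed density is convex along every coordinate direction. -/
theorem relaxZ_convex_entry {b : Prop} {W : Mat m N → ℝ≥0∞} (hfin : ∀ F, relaxZ b W F ≠ ⊤)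
    (F : Mat m N) (i : Fin m) (j : Fin N) (t : ℝ) {μ : ℝ} (hμ0 : 0 < μ) (hμ1 : μ < 1) :
    (relaxZ b W F).toReal ≤ μ * (relaxZ b W (F + Matrix.single i j (t * (1 - μ)))).toReal
      + (1 - μ) * (relaxZ b W (F + Matrix.single i j (t * (-μ)))).toReal := by
  classical
  set z := fun A => (relaxZ b W A).toReal
  have hz : ∀ A, relaxZ b W A = ENNReal.ofReal (z A) := fun A =>
    (ENNReal.ofReal_toReal (hfin A)).symm
  have hz0 : ∀ A, 0 ≤ z A := fun A => ENNReal.toReal_nonneg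
  -- A sum over all possible slopes bounds the value at each of them. It does not depend on `ε`, so
  -- the layers contribute only `O(ε²)`.
  set M : ℝ := ∑ l ∈ (lamSlopes_finite j μ).toFinset, z (F + rowMat i (t • l))
  have hM0 : 0 ≤ M := Finset.sum_nonneg fun l _ => hz0 _
  set z₁ := z (F + Matrix.single i j (t * (1 - μ)))
  set z₂ := z (F + Matrix.single i j (t * (-μ)))
  show z F ≤ μ * z₁ + (1 - μ) * z₂
  have key : ∀ ε : ℝ, 0 < ε → ε ≤ 1 → z F ≤ μ * z₁ + (1 - μ) * z₂ + ε * (2 * N * M) := by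
    intro ε hε0 hε1
    have h1 := relaxZ_le_lintegral_relaxZ hfin F (adm_laminate i j t (ε := ε) hμ0.le hμ1.le hε1)
    have h2 := lintegral_laminate_le i j t hμ0 hμ1 hε0 (fun A => relaxZ b W (F + A))
      (M := ENNReal.ofReal M) (by
        intro l hl
        rw [hz]
        exact ENNReal.ofReal_le_ofReal (Finset.single_le_sum
          (f := fun l => z (F + rowMat i (t • l))) (fun _ _ => hz0 _)
          ((lamSlopes_finite j μ).mem_toFinset.2 hl)))
    have h3 := h1.trans h2
    rw [rowMat_smul_proj, rowMat_smul_proj, add_zero, hz F, hz, hz] at h3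
    rw [← ENNReal.ofReal_mul (by linarith), ← ENNReal.ofReal_mul (by positivity),
      ← ENNReal.ofReal_mul (mul_nonneg (by linarith) hε0.le), ← ENNReal.ofReal_mul (by positivity),
      ← ENNReal.ofReal_natCast, ← ENNReal.ofReal_mul (by positivity),
      ← ENNReal.ofReal_add (mul_nonneg (by linarith) (hz0 _)) (mul_nonneg (by positivity) (hz0 _)),
      ← ENNReal.ofReal_add (add_nonneg (mul_nonneg (by linarith) (hz0 _))
        (mul_nonneg (by positivity) (hz0 _)))
        (mul_nonneg (mul_nonneg (by linarith) hε0.le) (hz0 _)),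
      ← ENNReal.ofReal_add (add_nonneg (add_nonneg (mul_nonneg (by linarith) (hz0 _))
        (mul_nonneg (by positivity) (hz0 _)))
        (mul_nonneg (mul_nonneg (by linarith) hε0.le) (hz0 _))) (by positivity),
      ENNReal.ofReal_le_ofReal_iff (add_nonneg (add_nonneg (add_nonneg
        (mul_nonneg (by linarith) (hz0 _)) (mul_nonneg (by positivity) (hz0 _)))
        (mul_nonneg (mul_nonneg (by linarith) hε0.le) (hz0 _))) (by positivity))] at h3
    -- The region beyond the slab contributes `(1 - ε) z F`; cancelling it leaves `ε z F`, and
    -- dividing by `ε` keeps an error of order `ε`.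
    have h4 : ε * z F ≤ ε * (μ * z₁ + (1 - μ) * z₂ + ε * (2 * N * M)) := by
      simp only [z₁, z₂]
      linarith
    exact le_of_mul_le_mul_left h4 hε0
  have hlim : Tendsto (fun ε : ℝ => μ * z₁ + (1 - μ) * z₂ + ε * (2 * N * M)) (𝓝[>] 0)
      (𝓝 (μ * z₁ + (1 - μ) * z₂)) := by
    have hc : Continuous fun ε : ℝ => μ * z₁ + (1 - μ) * z₂ + ε * (2 * N * M) := by fun_prop
    have := hc.tendsto 0
    simp only [zero_mul, add_zero] at this
    exact this.mono_left nhdsWithin_le_nhds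
  refine ge_of_tendsto hlim ?_
  filter_upwards [Ioc_mem_nhdsGT (zero_lt_one' ℝ)] with ε hε using key ε hε.1 hε.2

/-- The matrix with a given family of entries. -/
def matOfEntries (x : Fin m × Fin N → ℝ) : Mat m N := Matrix.of fun i j => x (i, j)

theorem matOfEntries_update (x : Fin m × Fin N → ℝ) (i : Fin m) (j : Fin N) (s t : ℝ) :
    matOfEntries (Function.update x (i, j) s) + Matrix.single i j (t - s)
      = matOfEntries (Function.update x (i, j) t) := by
  ext a c
  simp only [matOfEntries, Matrix.add_apply, Matrix.of_apply, Matrix.single_apply]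
  by_cases h : a = i ∧ c = j
  · obtain ⟨rfl, rfl⟩ := h
    simp
  · have h2 : ¬ (i = a ∧ j = c) := fun h2 => h ⟨h2.1.symm, h2.2.symm⟩
    have h3 : (a, c) ≠ (i, j) := fun h3 => h ⟨congrArg Prod.fst h3, congrArg Prod.snd h3⟩
    rw [if_neg h2, Function.update_of_ne h3, Function.update_of_ne h3, add_zero]

theorem relaxZ_separately_convex {b : Prop} {W : Mat m N → ℝ≥0∞} (hfin : ∀ F, relaxZ b W F ≠ ⊤)
    (x : Fin m × Fin N → ℝ) (k : Fin m × Fin N) :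
    ConvexOn ℝ univ fun t => (relaxZ b W (matOfEntries (Function.update x k t))).toReal := by
  obtain ⟨i, j⟩ := k
  refine convexOn_iff_forall_pos.2 ⟨convex_univ, fun s _ t _ α β hα hβ hαβ => ?_⟩
  -- With weight `α` and amplitude `s - t` around the entry `α s + β t`, the two laminate gradients
  -- have exactly the entries `s` and `t`.
  have h := relaxZ_convex_entry hfin (matOfEntries (Function.update x (i, j) (α * s + β * t))) i j
    (s - t) hα (by linarith)
  obtain rfl : β = 1 - α := by linarith
  have e1 : (s - t) * (1 - α) = s - (α * s + (1 - α) * t) := by ring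
  have e2 : (s - t) * (-α) = t - (α * s + (1 - α) * t) := by ring
  rw [e2, e1, matOfEntries_update, matOfEntries_update] at h
  exact h

/-- The finite relaxed density is continuous. -/
theorem continuous_relaxZ {b : Prop} {W : Mat m N → ℝ≥0∞} (hfin : ∀ F, relaxZ b W F ≠ ⊤) :
    Continuous (relaxZ b W) := by
  have hcont := continuous_of_separately_convex
    (g := fun x => (relaxZ b W (matOfEntries x)).toReal)
    (fun x => ENNReal.toReal_nonneg) (relaxZ_separately_convex hfin)
  have hentries : Continuous fun (F : Mat m N) (k : Fin m × Fin N) => F k.1 k.2 :=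
    continuous_pi fun k => continuous_id.matrix_elem k.1 k.2
  refine (ENNReal.continuous_ofReal.comp (hcont.comp hentries)).congr fun F => ?_
  exact ENNReal.ofReal_toReal (hfin F)

/-! ### Extension by zero -/

/-- Follow the segment from `x` towards `z` up to its first exit `γ t₀` from `D`. Before `t₀` the
segment stays in `D` and `hseg` applies; continuity up to the boundary and `φ (γ t₀) = 0` give the
bound as `t → t₀`. -/
theorem norm_le_of_exit {E' : Type*} [NormedAddCommGroup E'] {D : Set (Euc N)}
    (hD : IsOpen D) {φ : Euc N → E'} {K : ℝ≥0}
    (hseg : ∀ x y, segment ℝ x y ⊆ D → dist (φ x) (φ y) ≤ K * dist x y)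
    (hc : ContinuousOn φ (closure D)) (h0 : ∀ x ∈ frontier D, φ x = 0) {x z : Euc N} (hx : x ∈ D)
    (hz : z ∉ D) : ‖φ x‖ ≤ K * dist x z := by
  let γ : ℝ → Euc N := fun t => AffineMap.lineMap x z t
  have hγ : Continuous γ := AffineMap.lineMap_continuous
  have hT : IsCompact (Icc (0 : ℝ) 1 ∩ γ ⁻¹' Dᶜ) :=
    isCompact_Icc.inter_right (hD.isClosed_compl.preimage hγ)
  obtain ⟨t₀, ⟨ht₀I, ht₀D⟩, hleast⟩ := hT.exists_isLeast
    ⟨1, ⟨zero_le_one, le_rfl⟩, by simpa [γ] using hz⟩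
  have hin : ∀ t, 0 ≤ t → t < t₀ → γ t ∈ D := by
    intro t ht htt
    by_contra hn
    exact absurd (hleast ⟨⟨ht, htt.le.trans ht₀I.2⟩, hn⟩) (not_le.2 htt)
  have ht₀pos : 0 < t₀ := by
    refine ht₀I.1.lt_of_ne fun h => ht₀D ?_
    rw [← h]; simpa [γ] using hx
  have hcl : γ t₀ ∈ closure D := by
    refine mem_closure_of_tendsto ((hγ.tendsto t₀).mono_left nhdsWithin_le_nhds : Tendsto γ (𝓝[<] t₀) _) ?_
    filter_upwards [Ioo_mem_nhdsLT ht₀pos] with t ht using hin t ht.1.le ht.2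
  have hfr : φ (γ t₀) = 0 := h0 _ ⟨hcl, by rwa [hD.interior_eq]⟩
  have hle : ∀ t ∈ Ioo 0 t₀, dist (φ x) (φ (γ t)) ≤ K * dist x z := by
    intro t ht
    have hs : segment ℝ x (γ t) ⊆ D := by
      rw [segment_eq_image_lineMap]
      rintro _ ⟨s, hs, rfl⟩
      have h1 : AffineMap.lineMap x (γ t) s = γ (s * t) := by
        simp only [γ, AffineMap.lineMap_apply, vsub_eq_sub, vadd_eq_add]
        module
      rw [h1]
      refine hin _ (mul_nonneg hs.1 ht.1.le) ?_
      exact (mul_le_of_le_one_left ht.1.le hs.2).trans_lt ht.2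
    refine (hseg x (γ t) hs).trans ?_
    have h2 : dist x (γ t) = t * dist x z := by
      simp only [γ, dist_left_lineMap, Real.norm_eq_abs, abs_of_pos ht.1]
    rw [h2]
    have h3 : t ≤ 1 := ht.2.le.trans ht₀I.2
    have h4 : t * dist x z ≤ dist x z := mul_le_of_le_one_left dist_nonneg h3
    gcongr
  have hlim : Tendsto (fun t => dist (φ x) (φ (γ t))) (𝓝[Ioo 0 t₀] t₀) (𝓝 (dist (φ x) (φ (γ t₀)))) := by
    refine tendsto_const_nhds.dist ?_
    have h5 : Tendsto γ (𝓝[Ioo 0 t₀] t₀) (𝓝[closure D] (γ t₀)) := by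
      refine tendsto_nhdsWithin_iff.2 ⟨(hγ.tendsto t₀).mono_left nhdsWithin_le_nhds, ?_⟩
      filter_upwards [self_mem_nhdsWithin] with t ht using subset_closure (hin t ht.1.le ht.2)
    exact (hc _ hcl).tendsto.comp h5
  have : (𝓝[Ioo 0 t₀] t₀).NeBot := by
    rw [← mem_closure_iff_nhdsWithin_neBot, closure_Ioo ht₀pos.ne]
    exact ⟨ht₀pos.le, le_rfl⟩
  have hfin := le_of_tendsto hlim (eventually_mem_nhdsWithin.mono hle)
  rwa [hfr, dist_zero_right] at hfin

/-- The extension by zero of a function which is Lipschitz along segments contained in an open set,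
continuous up to the boundary, and zero there, is Lipschitz. -/
theorem lipschitzWith_indicator {E' : Type*} [NormedAddCommGroup E'] {D : Set (Euc N)}
    (hD : IsOpen D) {φ : Euc N → E'} {K : ℝ≥0}
    (hseg : ∀ x y, segment ℝ x y ⊆ D → dist (φ x) (φ y) ≤ K * dist x y)
    (hc : ContinuousOn φ (closure D)) (h0 : ∀ x ∈ frontier D, φ x = 0) :
    LipschitzWith K (D.indicator φ) := by
  classical
  refine LipschitzWith.of_dist_le_mul fun x y => ?_
  by_cases hx : x ∈ D <;> by_cases hy : y ∈ D
  · rw [indicator_of_mem hx, indicator_of_mem hy]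
    by_cases hs : segment ℝ x y ⊆ D
    · exact hseg x y hs
    -- A segment that leaves `D` at `z` is split there: the norms of `φ x` and `φ y` are controlled
    -- by the distances to `z`, which add up to `dist x y`.
    · obtain ⟨z, hz, hzD⟩ := not_subset.1 hs
      have h1 := norm_le_of_exit hD hseg hc h0 hx hzD
      have h2 := norm_le_of_exit hD hseg hc h0 hy hzD
      have h3 := dist_add_dist_of_mem_segment hz
      have h4 : dist (φ x) (φ y) ≤ ‖φ x‖ + ‖φ y‖ := dist_le_norm_add_norm _ _
      rw [← h3, dist_comm z y, mul_add]
      linarith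
  · rw [indicator_of_mem hx, indicator_of_notMem hy, dist_zero_right]
    exact norm_le_of_exit hD hseg hc h0 hx hy
  · rw [indicator_of_notMem hx, indicator_of_mem hy, dist_zero_left, dist_comm]
    exact norm_le_of_exit hD hseg hc h0 hy hx
  · rw [indicator_of_notMem hx, indicator_of_notMem hy, dist_self]
    positivity

/-! ### Piecewise affine approximation by tangent planes -/

theorem abs_sub_taylor_le {f : Euc N → ℝ} (hf : Differentiable ℝ f) {L : ℝ≥0}
    (hL : LipschitzWith L (fderiv ℝ f)) (x z : Euc N) :
    |f x - (f z + fderiv ℝ f z (x - z))| ≤ L * ‖x - z‖ ^ 2 := by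
  have h := (convex_segment z x).norm_image_sub_le_of_norm_hasFDerivWithin_le'
    (f := f) (f' := fderiv ℝ f) (φ := fderiv ℝ f z) (C := L * ‖x - z‖)
    (fun y _ => (hf y).hasFDerivAt.hasFDerivWithinAt)
    (fun y hy => by
      rw [← dist_eq_norm]
      refine (hL.dist_le_mul y z).trans ?_
      have h1 : dist y z ≤ ‖x - z‖ := by
        have h2 := dist_add_dist_of_mem_segment hy
        rw [dist_comm, ← dist_eq_norm, dist_comm x z, ← h2]
        linarith [dist_nonneg (x := y) (y := x)]
      gcongr) (left_mem_segment ℝ z x) (right_mem_segment ℝ z x)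
  rw [Real.norm_eq_abs] at h
  have e : f x - (f z + fderiv ℝ f z (x - z)) = f x - f z - fderiv ℝ f z (x - z) := by ring
  rw [e]
  exact h.trans (le_of_eq (by ring))

/-- The tangent plane at `z` of `f + C |x|²`. -/
noncomputable def tanPlane (f : Euc N → ℝ) (C : ℝ) (z : Euc N) : (Euc N →L[ℝ] ℝ) × ℝ :=
  (fderiv ℝ f z + (2 * C) • innerSL ℝ z, f z - fderiv ℝ f z z - C * ‖z‖ ^ 2)

theorem tanPlane_apply (f : Euc N → ℝ) (C : ℝ) (z x : Euc N) :
    (tanPlane f C z).1 x + (tanPlane f C z).2 =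
      f z + fderiv ℝ f z (x - z) - C * ‖x - z‖ ^ 2 + C * ‖x‖ ^ 2 := by
  have h := norm_sub_sq_real x z
  rw [h, map_sub, real_inner_comm]
  simp only [tanPlane, add_apply, smul_apply, innerSL_apply_apply, smul_eq_mul]
  ring

/-- The maximum of the tangent planes of `f + C |x|²` at the points of a finite set. -/
noncomputable def maxPlane (f : Euc N → ℝ) (C : ℝ) (X : Finset (Euc N)) (hX : X.Nonempty)
    (x : Euc N) : ℝ :=
  X.sup' hX fun z => (tanPlane f C z).1 x + (tanPlane f C z).2

theorem le_maxPlane (f : Euc N → ℝ) (C : ℝ) {X : Finset (Euc N)} (hX : X.Nonempty) (x : Euc N)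
    {z : Euc N} (hz : z ∈ X) :
    (tanPlane f C z).1 x + (tanPlane f C z).2 ≤ maxPlane f C X hX x :=
  Finset.le_sup' (fun z => (tanPlane f C z).1 x + (tanPlane f C z).2) hz

theorem maxPlane_selection (f : Euc N → ℝ) (C : ℝ) {X : Finset (Euc N)} (hX : X.Nonempty)
    (x : Euc N) : ∃ z ∈ X, maxPlane f C X hX x = (tanPlane f C z).1 x + (tanPlane f C z).2 :=
  Finset.exists_mem_eq_sup' hX _

theorem exists_lipschitz_maxPlane (f : Euc N → ℝ) (C : ℝ) {X : Finset (Euc N)} (hX : X.Nonempty) :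
    ∃ K, LipschitzWith K (maxPlane f C X hX) := by
  have h := Finset.sup'_induction (p := fun g : Euc N → ℝ => ∃ K, LipschitzWith K g) hX
    (fun z x => (tanPlane f C z).1 x + (tanPlane f C z).2)
    (fun g ⟨K, hK⟩ h ⟨L, hL⟩ => ⟨_, hK.max hL⟩)
    (fun z _ => ⟨_, (tanPlane f C z).1.lipschitz.add (LipschitzWith.const _)⟩)
  obtain ⟨K, hK⟩ := h
  refine ⟨K, ?_⟩
  convert hK using 1
  funext x
  exact (Finset.sup'_apply hX (fun z (x : Euc N) => (tanPlane f C z).1 x + (tanPlane f C z).2) x).symm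

/-- Only tangent planes at nearby points are active. -/
theorem norm_sub_le_of_active {f : Euc N → ℝ} (hf : Differentiable ℝ f) {L : ℝ≥0}
    (hL : LipschitzWith L (fderiv ℝ f)) {X : Finset (Euc N)} (hX : X.Nonempty) {x z : Euc N}
    (hmax : maxPlane f (L + 1) X hX x = (tanPlane f (L + 1) z).1 x + (tanPlane f (L + 1) z).2)
    {δ : ℝ} (hδ : ∃ w ∈ X, ‖x - w‖ ≤ δ) : ‖x - z‖ ≤ (2 * L + 2) * δ := by
  obtain ⟨w, hw, hwδ⟩ := hδ
  have h1 := le_maxPlane f (L + 1) hX x hw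
  rw [hmax, tanPlane_apply, tanPlane_apply] at h1
  have h2 := abs_le.1 (abs_sub_taylor_le hf hL x w)
  have h3 := abs_le.1 (abs_sub_taylor_le hf hL x z)
  have hδ0 : 0 ≤ δ := (norm_nonneg _).trans hwδ
  have hL0 : (0 : ℝ) ≤ L := L.2
  have h4 : ‖x - z‖ ^ 2 ≤ (2 * L + 1) * ‖x - w‖ ^ 2 := by linarith [h2.2, h3.1]
  have h5 : ‖x - w‖ ^ 2 ≤ δ ^ 2 := by gcongr
  refine abs_le_of_sq_le_sq' ?_ (by positivity) |>.2
  calc ‖x - z‖ ^ 2 ≤ (2 * L + 1) * δ ^ 2 := h4.trans (by gcongr)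
    _ ≤ ((2 * L + 2) * δ) ^ 2 := by
      rw [mul_pow]
      gcongr
      nlinarith

theorem isCompact_closure_unitCube (N : ℕ) : IsCompact (closure (unitCube N)) := by
  refine (Metric.isBounded_closedBall (x := (0 : Euc N)) (r := N)).subset ?_ |>.isCompact_closure
  intro x hx
  rw [mem_closedBall_zero_iff]
  refine (norm_le_sum_abs x).trans ?_
  calc ∑ i, |x i| ≤ ∑ _i : Fin N, (1 : ℝ) := Finset.sum_le_sum fun i _ =>
        abs_le.2 ⟨by linarith [(hx i).1], (hx i).2.le⟩
    _ = N := by simp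

theorem exists_net (N : ℕ) {δ : ℝ} (hδ : 0 < δ) : ∃ X : Finset (Euc N), X.Nonempty ∧
    ∀ x ∈ closure (unitCube N), ∃ w ∈ X, ‖x - w‖ ≤ δ := by
  obtain ⟨t, -, ht, hcov⟩ := (isCompact_closure_unitCube N).finite_cover_balls hδ
  have hnet : ∀ x ∈ closure (unitCube N), ∃ w ∈ ht.toFinset, ‖x - w‖ ≤ δ := by
    intro x hx
    obtain ⟨w, hw, hxw⟩ := mem_iUnion₂.1 (hcov hx)
    exact ⟨w, ht.mem_toFinset.2 hw, (mem_ball_iff_norm.1 hxw).le⟩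
  refine ⟨ht.toFinset, ?_, hnet⟩
  have hc : (WithLp.toLp 2 fun _ => 1 / 2 : Euc N) ∈ unitCube N := fun i => by norm_num
  obtain ⟨w, hw, -⟩ := hnet _ (subset_closure hc)
  exact ⟨w, hw⟩

/-- A smooth function with compact support in the unit cube is approximated, together with its
gradient, by continuous piecewise affine functions vanishing off the cube. -/
theorem exists_piecewise_affine_approx {f : Euc N → ℝ} (hf : ContDiff ℝ ∞ f)
    (hsupp : HasCompactSupport f) (hY : tsupport f ⊆ unitCube N) {η : ℝ} (hη : 0 < η) :
    ∃ v : Euc N → ℝ, (∃ K, LipschitzWith K v) ∧ (∀ x ∉ unitCube N, v x = 0) ∧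
      (∃ P : Set ((Euc N →L[ℝ] ℝ) × ℝ), P.Finite ∧ ∀ x, ∃ p ∈ P, v x = p.1 x + p.2) ∧
      ∀ᵐ x ∂(volume : Measure (Euc N)), x ∈ unitCube N → ∃ p : (Euc N →L[ℝ] ℝ) × ℝ,
        (∀ᶠ y in 𝓝 x, v y = p.1 y + p.2) ∧ ‖p.1 - fderiv ℝ f x‖ ≤ η := by
  classical
  have hfd : Differentiable ℝ f := hf.differentiable (by simp)
  obtain ⟨L, hL⟩ := ContDiff.lipschitzWith_of_hasCompactSupport (𝕂 := ℝ) (n := 1)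
    (hsupp.fderiv ℝ) (hf.fderiv_right (m := 1) (by norm_cast)) one_ne_zero
  have hL0 : (0 : ℝ) ≤ L := L.2
  obtain ⟨ρ, hρ, hρY⟩ := IsCompact.exists_cthickening_subset_open hsupp (isOpen_unitCube N) hY
  set c : ℝ := 2 * L + 2
  have hc : 0 < c := by positivity
  -- Active points lie within `c δ` of `x`. The first term accounts for the variation of `fderiv ℝ
  -- f` over that distance, the second for the difference of the slopes coming from the two
  -- quadratic terms.
  set κ : ℝ := L * c + 2 * (L + 1) * (c + c)
  have hκ : 0 < κ := by positivity
  -- The first bound makes the gradient error at most `η`; the second keeps active points off the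
  -- support when `x` is farther than `ρ` from it.
  set δ : ℝ := min (η / κ) (ρ / c)
  have hδ : 0 < δ := by positivity
  have hδη : κ * δ ≤ η := by
    calc κ * δ ≤ κ * (η / κ) := by gcongr; exact min_le_left _ _
      _ = η := mul_div_cancel₀ _ hκ.ne'
  have hδρ : c * δ ≤ ρ := by
    calc c * δ ≤ c * (ρ / c) := by gcongr; exact min_le_right _ _
      _ = ρ := mul_div_cancel₀ _ hc.ne'
  obtain ⟨X, hX, hnet⟩ := exists_net N hδ
  set C : ℝ := L + 1
  -- `maxPlane f` approximates `f + C |x|²`. Subtracting the same construction for the zero function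
  -- removes `C |x|²` while staying piecewise affine.
  let f₀ : Euc N → ℝ := fun _ => 0
  have hf₀ : Differentiable ℝ f₀ := differentiable_const 0
  have hL₀ : LipschitzWith L (fderiv ℝ f₀) := by
    have : fderiv ℝ f₀ = fun _ => 0 := by funext x; simp [f₀]
    rw [this]
    exact (LipschitzWith.const (0 : Euc N →L[ℝ] ℝ)).weaken (zero_le)
  let v₀ : Euc N → ℝ := fun x => maxPlane f C X hX x - maxPlane f₀ C X hX x
  obtain ⟨K₁, hK₁⟩ := exists_lipschitz_maxPlane f C hX
  obtain ⟨K₂, hK₂⟩ := exists_lipschitz_maxPlane f₀ C hX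
  have hv₀ : LipschitzWith (K₁ + K₂) v₀ := hK₁.sub hK₂
  -- Far from the support, the planes active for either maximum are tangent at points where `f` and
  -- its derivative vanish. There the two families coincide, so the maxima are equal exactly, not
  -- just approximately.
  have hvanish : ∀ x ∈ closure (unitCube N), x ∉ Metric.cthickening ρ (tsupport f) → v₀ x = 0 := by
    intro x hx hxρ
    have hplane : ∀ z, ‖x - z‖ ≤ c * δ → tanPlane f C z = tanPlane f₀ C z := by
      intro z hz
      have hzs : z ∉ tsupport f := fun hzs => hxρ
        (Metric.mem_cthickening_of_dist_le x z ρ _ hzs (by rw [dist_eq_norm]; exact hz.trans hδρ))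
      have h1 : f z = 0 := image_eq_zero_of_notMem_tsupport hzs
      have h2 : fderiv ℝ f z = 0 := fderiv_of_notMem_tsupport ℝ hzs
      simp [tanPlane, h1, h2, f₀]
    obtain ⟨z, hzX, hz⟩ := maxPlane_selection f C hX x
    obtain ⟨z', hzX', hz'⟩ := maxPlane_selection f₀ C hX x
    have h1 := norm_sub_le_of_active hfd hL hX hz (hnet x hx)
    have h2 := norm_sub_le_of_active hf₀ hL₀ hX hz' (hnet x hx)
    have h3 := le_maxPlane f C hX x hzX'
    have h4 := le_maxPlane f₀ C hX x hzX
    rw [hplane z' h2, ← hz'] at h3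
    rw [← hplane z h1, ← hz] at h4
    simp only [v₀]
    linarith
  refine ⟨(unitCube N).indicator v₀, ⟨K₁ + K₂, ?_⟩, ?_, ?_, ?_⟩
  · refine lipschitzWith_indicator (isOpen_unitCube N) (fun x y _ => hv₀.dist_le_mul x y)
      hv₀.continuous.continuousOn fun x hx => hvanish x (frontier_subset_closure hx) fun h => ?_
    have h1 := hρY h
    rw [frontier, (isOpen_unitCube N).interior_eq] at hx
    exact hx.2 h1
  · exact fun x hx => indicator_of_notMem hx _
  · refine ⟨{0} ∪ (fun z : Euc N × Euc N => tanPlane f C z.1 - tanPlane f₀ C z.2) '' (X ×ˢ X : Finset _),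
      (Set.finite_singleton _).union ((Finset.finite_toSet _).image _), fun x => ?_⟩
    by_cases hx : x ∈ unitCube N
    · obtain ⟨z, hzX, hz⟩ := maxPlane_selection f C hX x
      obtain ⟨z', hzX', hz'⟩ := maxPlane_selection f₀ C hX x
      refine ⟨_, Or.inr ⟨(z, z'), by simp [hzX, hzX'], rfl⟩, ?_⟩
      rw [indicator_of_mem hx]
      simp only [v₀, hz, hz', Prod.fst_sub, Prod.snd_sub, sub_apply]
      ring
    · exact ⟨0, Or.inl rfl, by rw [indicator_of_notMem hx]; simp⟩
  · have hsel : ∀ g : Euc N → ℝ, ∀ x, ∃ p ∈ tanPlane g C '' (X : Set (Euc N)),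
        maxPlane g C X hX x = p.1 x + p.2 := by
      intro g x
      obtain ⟨z, hzX, hz⟩ := maxPlane_selection g C hX x
      exact ⟨_, ⟨z, hzX, rfl⟩, hz⟩
    filter_upwards [ae_locally_affine (X.finite_toSet.image _) hK₁.continuous (hsel f),
      ae_locally_affine (X.finite_toSet.image _) hK₂.continuous (hsel f₀)] with x h1 h2 hx
    obtain ⟨_, ⟨z, hzX, rfl⟩, hz⟩ := h1
    obtain ⟨_, ⟨z', hzX', rfl⟩, hz'⟩ := h2
    refine ⟨tanPlane f C z - tanPlane f₀ C z', ?_, ?_⟩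
    · filter_upwards [hz, hz', (isOpen_unitCube N).mem_nhds hx] with y hy hy' hyY
      rw [indicator_of_mem hyY]
      simp only [v₀, hy, hy', Prod.fst_sub, Prod.snd_sub, sub_apply]
      ring
    · have h3 := norm_sub_le_of_active hfd hL hX hz.self_of_nhds (hnet x (subset_closure hx))
      have h4 := norm_sub_le_of_active hf₀ hL₀ hX hz'.self_of_nhds (hnet x (subset_closure hx))
      have h5 : (tanPlane f C z - tanPlane f₀ C z').1 - fderiv ℝ f x =
          (fderiv ℝ f z - fderiv ℝ f x) + (2 * C) • innerSL ℝ (z - z') := by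
        have h6 : fderiv ℝ f₀ z' = 0 := by simp [f₀]
        simp only [tanPlane, Prod.fst_sub, h6, zero_add, map_sub, smul_sub]
        abel
      rw [h5]
      have h7 : ‖fderiv ℝ f z - fderiv ℝ f x‖ ≤ L * (c * δ) := by
        rw [← dist_eq_norm, dist_comm]
        refine (hL.dist_le_mul x z).trans ?_
        rw [dist_eq_norm]
        gcongr
      have h8 : ‖z - z'‖ ≤ c * δ + c * δ := by
        have h9 : z - z' = (x - z') - (x - z) := by abel
        rw [h9]
        exact (norm_sub_le _ _).trans (add_le_add h4 h3)
      calc ‖(fderiv ℝ f z - fderiv ℝ f x) + (2 * C) • innerSL ℝ (z - z')‖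
          ≤ ‖fderiv ℝ f z - fderiv ℝ f x‖ + ‖(2 * C) • innerSL ℝ (z - z')‖ := norm_add_le _ _
        _ ≤ L * (c * δ) + (2 * C) * (c * δ + c * δ) := by
          refine add_le_add h7 ?_
          rw [norm_smul, innerSL_apply_norm, Real.norm_of_nonneg (by positivity)]
          gcongr
        _ = κ * δ := by simp only [κ, C]; ring
        _ ≤ η := hδη

/-! ### Passing to the limit: Jensen's inequality for smooth functions -/

/-- Dominated convergence on a set of measure one: matrices with entries in `[-B, B]` form a compact
set, on which the finite continuous `g (F + ·)` is bounded by a finite constant. -/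
theorem tendsto_lintegral_comp {g : Mat m N → ℝ≥0∞} (hg : Continuous g) (hfin : ∀ A, g A ≠ ⊤)
    (F : Mat m N) {G : ℕ → Euc N → Mat m N} {H : Euc N → Mat m N} (hG : ∀ n, Measurable (G n))
    {B : ℝ} (hB : ∀ n, ∀ᵐ x ∂(volume.restrict (unitCube N)), ∀ i j, |G n x i j| ≤ B)
    (hlim : ∀ᵐ x ∂(volume.restrict (unitCube N)), ∀ i j,
      Tendsto (fun n => G n x i j) atTop (𝓝 (H x i j))) :
    Tendsto (fun n => ∫⁻ y in unitCube N, g (F + G n y)) atTop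
      (𝓝 (∫⁻ y in unitCube N, g (F + H y))) := by
  have hgF : Continuous fun A => g (F + A) := hg.comp (continuous_const.add continuous_id)
  have hK : IsCompact {A : Mat m N | ∀ i j, A i j ∈ Icc (-B) B} := by
    have h : IsCompact (Set.pi univ fun _ : Fin m => Set.pi univ fun _ : Fin N => Icc (-B) B) :=
      isCompact_univ_pi fun _ => isCompact_univ_pi fun _ => isCompact_Icc
    have hset : (Set.pi univ fun _ : Fin m => Set.pi univ fun _ : Fin N => Icc (-B) B)
        = {A : Fin m → Fin N → ℝ | ∀ i j, A i j ∈ Icc (-B) B} := by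
      ext A
      simp only [Set.mem_pi, mem_univ, true_implies, mem_ofPred_eq]
    rw [hset] at h
    exact h
  obtain ⟨M, hM, hMle⟩ : ∃ M : ℝ≥0∞, M ≠ ⊤ ∧ ∀ A : Mat m N, (∀ i j, |A i j| ≤ B) → g (F + A) ≤ M := by
    rcases Set.eq_empty_or_nonempty {A : Mat m N | ∀ i j, A i j ∈ Icc (-B) B} with he | hne
    · refine ⟨0, by simp, fun A hA => ?_⟩
      have : A ∈ {A : Mat m N | ∀ i j, A i j ∈ Icc (-B) B} := fun i j => abs_le.1 (hA i j)
      rw [he] at this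
      exact absurd this (Set.notMem_empty A)
    · obtain ⟨A₀, -, hA₀⟩ := hK.exists_isMaxOn hne hgF.continuousOn
      exact ⟨g (F + A₀), hfin _, fun A hA => hA₀ fun i j => abs_le.1 (hA i j)⟩
  refine tendsto_lintegral_of_dominated_convergence (fun _ => M)
    (fun n => hgF.measurable.comp (hG n)) (fun n => ?_) ?_ ?_
  · filter_upwards [hB n] with x hx using hMle _ hx
  · rw [setLIntegral_const, volume_unitCube, mul_one]; exact hM
  · filter_upwards [hlim] with x hx
    have h1 : Tendsto (fun n => G n x) atTop (𝓝 (H x)) :=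
      tendsto_pi_nhds.2 fun i => tendsto_pi_nhds.2 fun j => hx i j
    exact (hgF.tendsto (H x)).comp h1

theorem exists_lipschitz_of_components {u : Euc N → Euc m}
    (h : ∀ i, ∃ K, LipschitzWith K fun x => u x i) : ∃ K, LipschitzWith K u := by
  choose K hK using h
  refine ⟨∑ i, K i, LipschitzWith.of_dist_le_mul fun x y => ?_⟩
  rw [dist_eq_norm]
  refine (norm_le_sum_abs _).trans ?_
  push_cast
  rw [Finset.sum_mul]
  exact Finset.sum_le_sum fun i _ => (hK i).dist_le_mul x y

theorem hasFDerivAt_component {u : Euc N → Euc m} {x : Euc N} (hu : DifferentiableAt ℝ u x)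
    (i : Fin m) :
    HasFDerivAt (fun y => u y i) ((EuclideanSpace.proj (𝕜 := ℝ) i).comp (fderiv ℝ u x)) x :=
  (EuclideanSpace.proj (𝕜 := ℝ) i).hasFDerivAt.comp x hu.hasFDerivAt

theorem fderiv_component_apply {u : Euc N → Euc m} {x : Euc N} (hu : DifferentiableAt ℝ u x)
    (i : Fin m) (j : Fin N) :
    fderiv ℝ (fun y => u y i) x (EuclideanSpace.single j 1) = gradMat u x i j := by
  rw [(hasFDerivAt_component hu i).fderiv]; rfl

/-- The components are approximated separately, and the finitely many affine pieces of each supply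
the finite set of gradients. -/
theorem exists_adm_approx {u : Euc N → Euc m} (hu : ContDiff ℝ ∞ u) (hsupp : HasCompactSupport u)
    (hY : tsupport u ⊆ unitCube N) {η : ℝ} (hη : 0 < η) :
    ∃ v, Adm True (unitCube N) v ∧ ∀ᵐ x ∂(volume.restrict (unitCube N)), ∀ i j,
      |gradMat v x i j - gradMat u x i j| ≤ η := by
  have hsub : ∀ i, tsupport (fun x => u x i) ⊆ tsupport u := fun i =>
    closure_mono fun x hx h => hx (by simp [h])
  have hcomp := fun i => exists_piecewise_affine_approx (f := fun x => u x i)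
    ((contDiff_euclidean.1 hu) i)
    (hsupp.of_isClosed_subset (isClosed_tsupport _) (hsub i)) ((hsub i).trans hY) hη
  choose v hlip hoff hsel hae using hcomp
  choose P hP hsel using hsel
  let w : Euc N → Euc m := fun x => WithLp.toLp 2 fun i => v i x
  have hw : ∃ K, LipschitzWith K w := exists_lipschitz_of_components hlip
  refine ⟨w, ⟨hw, fun x hx => ?_, fun _ => ?_⟩, ?_⟩
  · ext i; exact hoff i x hx
  · obtain ⟨K, hK⟩ := hw
    exact finGrad_of_selection hK.continuous hP hsel _
  · rw [ae_restrict_iff' (isOpen_unitCube N).measurableSet]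
    filter_upwards [ae_all_iff.2 hae] with x hx hxY i j
    choose p hp hpη using fun i => hx i hxY
    rw [gradMat_of_locally_affine (u := w) hp, rowsMat, Matrix.of_apply,
      ← fderiv_component_apply (hu.differentiable (by simp) x), ← sub_apply,
      ← Real.norm_eq_abs]
    refine (ContinuousLinearMap.le_opNorm _ _).trans ?_
    simpa using hpη i

theorem relaxZ_le_lintegral_of_smooth {b : Prop} {W : Mat m N → ℝ≥0∞}
    (hfin : ∀ F, relaxZ b W F ≠ ⊤) (F : Mat m N) {u : Euc N → Euc m}
    (hu : ContDiff ℝ ∞ u) (hsupp : HasCompactSupport u) (hY : tsupport u ⊆ unitCube N) :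
    relaxZ b W F ≤ ∫⁻ y in unitCube N, relaxZ b W (F + gradMat u y) := by
  choose v hv hvae using fun n : ℕ =>
    exists_adm_approx hu hsupp hY (η := 1 / (n + 1)) (by positivity)
  obtain ⟨K, hK⟩ := ContDiff.lipschitzWith_of_hasCompactSupport (𝕂 := ℝ) hsupp hu (by simp)
  have hlim : Tendsto (fun n => ∫⁻ y in unitCube N, relaxZ b W (F + gradMat (v n) y)) atTop
      (𝓝 (∫⁻ y in unitCube N, relaxZ b W (F + gradMat u y))) := by
    refine tendsto_lintegral_comp (continuous_relaxZ hfin) hfin F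
      (fun n => measurable_gradMat (v n)) (B := K + 1) (fun n => ?_) ?_
    · filter_upwards [hvae n] with x hx i j
      have h1 := abs_gradMat_le hK x i j
      have h2 : (1 : ℝ) / (n + 1) ≤ 1 := by
        rw [div_le_one (by positivity)]; linarith [(Nat.cast_nonneg n : (0 : ℝ) ≤ n)]
      have h3 : gradMat (v n) x i j = gradMat u x i j + (gradMat (v n) x i j - gradMat u x i j) := by
        ring
      rw [h3]
      exact (abs_add_le _ _).trans (add_le_add h1 ((hx i j).trans h2))
    · filter_upwards [ae_all_iff.2 hvae] with x hx i j
      rw [tendsto_iff_dist_tendsto_zero]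
      exact squeeze_zero (fun _ => dist_nonneg) (fun n => hx n i j)
        tendsto_one_div_add_atTop_nhds_zero_nat
  exact ge_of_tendsto' hlim fun n => relaxZ_le_lintegral_relaxZ hfin F (hv n)

/-! ### Mollification: Jensen's inequality for Lipschitz functions -/

open scoped Convolution

/-- The derivative of a mollified function is the mollified weak derivative. -/
theorem fderiv_mollify {D : Set (Euc N)} {f g : Euc N → ℝ} (hf : LocallyIntegrable f volume)
    {e : Euc N} (hweak : ∀ η : Euc N → ℝ, ContDiff ℝ ∞ η → HasCompactSupport η → tsupport η ⊆ D →
      ∫ x, f x * fderiv ℝ η x e = -∫ x, g x * η x)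
    (φ : ContDiffBump (0 : Euc N)) {x : Euc N} (hx : Metric.closedBall x φ.rOut ⊆ D) :
    fderiv ℝ (φ.normed volume ⋆[ContinuousLinearMap.lsmul ℝ ℝ, volume] f) x e =
      (φ.normed volume ⋆[ContinuousLinearMap.lsmul ℝ ℝ, volume] g) x := by
  set ρ := φ.normed (volume : Measure (Euc N))
  have hρ : ContDiff ℝ ∞ ρ := φ.contDiff_normed
  have hρc : HasCompactSupport ρ := φ.hasCompactSupport_normed
  have h1 := (hρc.hasFDerivAt_convolution_left (ContinuousLinearMap.lsmul ℝ ℝ)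
    (hρ.of_le (by norm_cast)) hf x).fderiv
  have hex := (HasCompactSupport.convolutionExists_left
    ((ContinuousLinearMap.lsmul ℝ ℝ : ℝ →L[ℝ] ℝ →L[ℝ] ℝ).precompL (Euc N)) (hρc.fderiv ℝ)
    (hρ.continuous_fderiv (by simp)) hf x).integrable_swap
  -- The reflected kernel is a legitimate test function because its support lies in the ball around
  -- `x` contained in `D`; the reflection produces the sign that cancels that of the weak
  -- derivative.
  let η : Euc N → ℝ := fun t => ρ (x - t)
  have hη : ContDiff ℝ ∞ η := hρ.comp (contDiff_const.sub contDiff_id)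
  have hηsupp : tsupport η ⊆ Metric.closedBall x φ.rOut := by
    refine closure_minimal (fun t ht => ?_) Metric.isClosed_closedBall
    have h2 : x - t ∈ Function.support ρ := ht
    rw [φ.support_normed_eq, mem_ball_zero_iff] at h2
    rw [mem_closedBall_iff_norm, norm_sub_rev]
    exact h2.le
  have hηc : HasCompactSupport η :=
    HasCompactSupport.of_support_subset_isCompact (isCompact_closedBall x φ.rOut)
      (subset_closure.trans hηsupp)
  have hηd : ∀ t, fderiv ℝ η t e = -fderiv ℝ ρ (x - t) e := by
    intro t
    have h2 : HasFDerivAt (fun t => x - t) (-ContinuousLinearMap.id ℝ (Euc N)) t :=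
      (hasFDerivAt_id t).const_sub x
    have h3 : HasFDerivAt η ((fderiv ℝ ρ (x - t)).comp (-ContinuousLinearMap.id ℝ (Euc N))) t :=
      ((hρ.differentiable (by simp)) (x - t)).hasFDerivAt.comp t h2
    rw [h3.fderiv]
    simp
  have h4 := hweak η hη hηc (hηsupp.trans hx)
  rw [h1, convolution_eq_swap, ContinuousLinearMap.integral_apply hex, convolution_eq_swap]
  have h5 : ∀ t, ((ContinuousLinearMap.lsmul ℝ ℝ : ℝ →L[ℝ] ℝ →L[ℝ] ℝ).precompL (Euc N)
      (fderiv ℝ ρ (x - t)) (f t)) e = -(f t * fderiv ℝ η t e) := by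
    intro t
    rw [hηd t]
    simp [ContinuousLinearMap.precompL_apply]
    ring
  simp only [h5, integral_neg, h4, neg_neg, ContinuousLinearMap.lsmul_apply, smul_eq_mul]
  exact integral_congr_ae (Eventually.of_forall fun t => mul_comm _ _)

/-- Integration by parts against a Lipschitz function. -/
theorem integral_mul_fderiv_eq_neg {f : Euc N → ℝ} {K : ℝ≥0} (hf : LipschitzWith K f)
    {η : Euc N → ℝ} (hη : ContDiff ℝ ∞ η) (hηc : HasCompactSupport η) (e : Euc N) :
    ∫ x, f x * fderiv ℝ η x e = -∫ x, fderiv ℝ f x e * η x := by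
  obtain ⟨L, hL⟩ := ContDiff.lipschitzWith_of_hasCompactSupport (𝕂 := ℝ) hηc hη (by simp)
  have h := hf.integral_lineDeriv_mul_eq (μ := volume) hL hηc e
  have h1 : ∫ x, lineDeriv ℝ f x e * η x = ∫ x, fderiv ℝ f x e * η x := by
    refine integral_congr_ae ?_
    filter_upwards [hf.ae_differentiableAt (μ := volume)] with x hx
    rw [hx.lineDeriv_eq_fderiv]
  have h2 : ∫ x, lineDeriv ℝ η x (-e) * f x = -∫ x, f x * fderiv ℝ η x e := by
    rw [← integral_neg]
    refine integral_congr_ae (Eventually.of_forall fun x => ?_)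
    simp only
    rw [((hη.differentiable (by simp)) x).lineDeriv_eq_fderiv, map_neg]
    ring
  rw [h1, h2] at h
  rw [h, neg_neg]

theorem abs_mollify_le (φ : ContDiffBump (0 : Euc N)) {g : Euc N → ℝ} {B : ℝ}
    (hB : ∀ᵐ x ∂(volume : Measure (Euc N)), |g x| ≤ B) (x : Euc N) :
    |(φ.normed volume ⋆[ContinuousLinearMap.lsmul ℝ ℝ, volume] g) x| ≤ B := by
  rw [convolution_eq_swap, ← Real.norm_eq_abs]
  have hint : Integrable (fun t => φ.normed volume (x - t)) (volume : Measure (Euc N)) :=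
    φ.integrable_normed.comp_sub_left x
  have h1 : ∫ t, φ.normed volume (x - t) * B = B := by
    rw [integral_mul_const, integral_sub_left_eq_self (fun t => φ.normed volume t) volume x,
      φ.integral_normed, one_mul]
  rw [← h1]
  refine norm_integral_le_of_norm_le (hint.mul_const B) ?_
  filter_upwards [hB] with t ht
  rw [ContinuousLinearMap.lsmul_apply, norm_smul, Real.norm_of_nonneg (φ.nonneg_normed _)]
  exact mul_le_mul_of_nonneg_left ht (φ.nonneg_normed _)

theorem locallyIntegrable_of_ae_bound {g : Euc N → ℝ}
    (hg : AEStronglyMeasurable g (volume : Measure (Euc N))) {B : ℝ}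
    (hB : ∀ᵐ x ∂(volume : Measure (Euc N)), |g x| ≤ B) : LocallyIntegrable g volume :=
  (memLp_top_of_bound hg B hB).locallyIntegrable le_top

/-- Bump functions at the origin with radii tending to zero. -/
noncomputable def bumpSeq (N : ℕ) {r : ℝ} (hr : 0 < r) (n : ℕ) : ContDiffBump (0 : Euc N) where
  -- Keeping the ratio of radii equal to 2 is what allows almost everywhere convergence of the
  -- mollified gradients.
  rIn := r / (n + 1) / 2
  rOut := r / (n + 1)
  rIn_pos := by positivity
  rIn_lt_rOut := half_lt_self (by positivity)

theorem bumpSeq_rOut_le {r : ℝ} (hr : 0 < r) (n : ℕ) : (bumpSeq N hr n).rOut ≤ r :=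
  div_le_self hr.le (by linarith [(Nat.cast_nonneg n : (0 : ℝ) ≤ n)])

theorem tendsto_bumpSeq_rOut {r : ℝ} (hr : 0 < r) :
    Tendsto (fun n => (bumpSeq N hr n).rOut) atTop (𝓝 0) := by
  have h := (tendsto_one_div_add_atTop_nhds_zero_nat (𝕜 := ℝ)).const_mul r
  rw [mul_zero] at h
  exact h.congr fun n => by simp [bumpSeq, div_eq_mul_inv]

theorem measurable_fderiv_apply_real (f : Euc N → ℝ) (e : Euc N) :
    Measurable fun x => fderiv ℝ f x e := measurable_fderiv_apply_const ℝ f e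

theorem lipschitz_component {u : Euc N → Euc m} {K : ℝ≥0} (hu : LipschitzWith K u) (i : Fin m) :
    LipschitzWith K fun x => u x i :=
  LipschitzWith.of_dist_le_mul fun x y =>
    (PiLp.norm_apply_le (u x - u y) i).trans ((dist_eq_norm _ _).symm.le.trans (hu.dist_le_mul x y))

theorem abs_fderiv_component_le {u : Euc N → Euc m} {K : ℝ≥0} (hu : LipschitzWith K u) (i : Fin m)
    (j : Fin N) (x : Euc N) :
    |fderiv ℝ (fun y => u y i) x (EuclideanSpace.single j 1)| ≤ K := by
  have h1 := norm_fderiv_le_of_lipschitz ℝ (x₀ := x) (lipschitz_component hu i)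
  have h2 := (fderiv ℝ (fun y => u y i) x).le_opNorm (EuclideanSpace.single j (1 : ℝ))
  simp only [PiLp.norm_single, norm_one, mul_one, Real.norm_eq_abs] at h2
  exact h2.trans h1

/-- Jensen's inequality for Lipschitz functions supported in the open unit cube. -/
theorem relaxZ_le_lintegral_of_lipschitz {b : Prop} {W : Mat m N → ℝ≥0∞}
    (hfin : ∀ F, relaxZ b W F ≠ ⊤) (F : Mat m N) {u : Euc N → Euc m} {K : ℝ≥0}
    (hu : LipschitzWith K u) (hsupp : HasCompactSupport u) (hY : tsupport u ⊆ unitCube N) :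
    relaxZ b W F ≤ ∫⁻ y in unitCube N, relaxZ b W (F + gradMat u y) := by
  obtain ⟨r, hr, hrY⟩ := IsCompact.exists_cthickening_subset_open hsupp (isOpen_unitCube N) hY
  let φ := bumpSeq N hr
  let D : Fin m → Fin N → Euc N → ℝ := fun i j x =>
    fderiv ℝ (fun y => u y i) x (EuclideanSpace.single j 1)
  let w : ℕ → Euc N → Euc m := fun n x => WithLp.toLp 2 fun i =>
    ((φ n).normed volume ⋆[ContinuousLinearMap.lsmul ℝ ℝ, volume] fun y => u y i) x
  have hli : ∀ i, LocallyIntegrable (fun y => u y i) (volume : Measure (Euc N)) := fun i =>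
    (lipschitz_component hu i).continuous.locallyIntegrable
  have hDb : ∀ i j, ∀ᵐ x ∂(volume : Measure (Euc N)), |D i j x| ≤ K := fun i j =>
    Eventually.of_forall (abs_fderiv_component_le hu i j)
  have hwsmooth : ∀ n, ContDiff ℝ ∞ (w n) := by
    intro n
    rw [contDiff_euclidean]
    intro i
    exact (φ n).hasCompactSupport_normed.contDiff_convolution_left _ (φ n).contDiff_normed (hli i)
  have hwsub : ∀ n, tsupport (w n) ⊆ Metric.cthickening r (tsupport u) := by
    intro n
    refine closure_minimal (fun x hx => ?_) Metric.isClosed_cthickening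
    by_contra hn
    refine hx ?_
    ext i
    have hconv : ((φ n).normed volume ⋆[ContinuousLinearMap.lsmul ℝ ℝ, volume]
        fun y => u y i) x = 0 := by
      by_contra hne
      obtain ⟨s, hs, t, ht, hst⟩ := support_convolution_subset
        (ContinuousLinearMap.lsmul ℝ ℝ) (show x ∈ Function.support _ from hne)
      rw [(φ n).support_normed_eq, mem_ball_zero_iff] at hs
      refine hn (Metric.mem_cthickening_of_dist_le x t r _ (subset_closure fun h => ht ?_) ?_)
      · simp [h]
      · rw [← hst, dist_eq_norm]
        simp only [add_sub_cancel_right]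
        exact hs.le.trans (bumpSeq_rOut_le hr n)
    exact hconv
  have hwc : ∀ n, HasCompactSupport (w n) := fun n =>
    (IsCompact.cthickening hsupp).of_isClosed_subset (isClosed_tsupport _) (hwsub n)
  have hwgrad : ∀ n x i j, gradMat (w n) x i j =
      ((φ n).normed volume ⋆[ContinuousLinearMap.lsmul ℝ ℝ, volume] D i j) x := by
    intro n x i j
    rw [← fderiv_component_apply ((hwsmooth n).differentiable (by simp) x)]
    exact fderiv_mollify (D := univ) (hli i) (fun η hη hηc _ =>
      integral_mul_fderiv_eq_neg (lipschitz_component hu i) hη hηc _) (φ n) (subset_univ _)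
  have hlim : Tendsto (fun n => ∫⁻ y in unitCube N, relaxZ b W (F + gradMat (w n) y)) atTop
      (𝓝 (∫⁻ y in unitCube N, relaxZ b W (F + gradMat u y))) := by
    refine tendsto_lintegral_comp (continuous_relaxZ hfin) hfin F
      (fun n => measurable_gradMat (w n)) (B := K) (fun n => ?_) (ae_restrict_of_ae ?_)
    · refine Eventually.of_forall fun x i j => ?_
      rw [hwgrad]
      exact abs_mollify_le _ (hDb i j) x
    · have h1 : ∀ i j, ∀ᵐ x ∂(volume : Measure (Euc N)), Tendsto (fun n =>
          ((φ n).normed volume ⋆[ContinuousLinearMap.lsmul ℝ ℝ, volume] D i j) x) atTop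
          (𝓝 (D i j x)) := fun i j =>
        ContDiffBump.ae_convolution_tendsto_right_of_locallyIntegrable (K := 2)
          (tendsto_bumpSeq_rOut hr)
          (Eventually.of_forall fun n => by simp only [φ, bumpSeq]; linarith)
          (locallyIntegrable_of_ae_bound
            (measurable_fderiv_apply_real _ _).aestronglyMeasurable (hDb i j))
      filter_upwards [ae_all_iff.2 fun i => ae_all_iff.2 (h1 i),
        hu.ae_differentiableAt (μ := volume)] with x hx hxd i j
      rw [← fderiv_component_apply hxd]
      exact (hx i j).congr fun n => (hwgrad n x i j).symm
  exact ge_of_tendsto' hlim fun n =>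
    relaxZ_le_lintegral_of_smooth hfin F (hwsmooth n) (hwc n) ((hwsub n).trans hrY)

theorem closedBall_subset_unitCube :
    Metric.closedBall (WithLp.toLp 2 fun _ => 1 / 2 : Euc N) (1 / 4) ⊆ unitCube N := by
  intro x hx i
  rw [mem_closedBall_iff_norm] at hx
  have h1 := (PiLp.norm_apply_le (x - WithLp.toLp 2 fun _ => 1 / 2 : Euc N) i).trans hx
  rw [Real.norm_eq_abs, abs_le] at h1
  simp only [PiLp.sub_apply] at h1
  constructor <;> linarith [h1.1, h1.2]

/-! ### Jensen's inequality on general domains -/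

/-- Jensen's inequality for the finite relaxed density on bounded open sets with negligible
boundary. -/
theorem volume_mul_relaxZ_le {b : Prop} {W : Mat m N → ℝ≥0∞}
    (hfin : ∀ F, relaxZ b W F ≠ ⊤) (F : Mat m N) {D : Set (Euc N)} (hD : IsOpen D)
    (hDb : Bornology.IsBounded D) (hDf : volume (frontier D) = 0) {u : Euc N → Euc m} {K : ℝ≥0}
    (hu : LipschitzWith K u) (h0 : ∀ x ∉ D, u x = 0) :
    volume D * relaxZ b W F ≤ ∫⁻ x in D, relaxZ b W (F + gradMat u x) := by
  obtain ⟨R, hR, hDR⟩ := hDb.subset_ball_lt 0 0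
  set c : Euc N := WithLp.toLp 2 fun _ => 1 / 2
  -- This ratio sends the ball of radius `R` containing `D` to a ball of radius `1 / 4` about the
  -- centre of the cube.
  set r : ℝ := 1 / (4 * R)
  have hr : 0 < r := by positivity
  let w : Euc N → Euc m := fun x => r • u (toUnit c r x)
  have hw : LipschitzWith K w := toUnit_lipschitz_rescale hu c hr
  have hgrad : ∀ x, gradMat w x = gradMat u (toUnit c r x) := fun x =>
    gradMat_rescale u c x hr.ne'
  set E : Set (Euc N) := toUnit c r ⁻¹' D
  have hEo : IsOpen E := hD.preimage (continuous_toUnit c r)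
  have hEball : E ⊆ Metric.closedBall c (1 / 4) := by
    intro x hx
    have h1 := mem_ball_zero_iff.1 (hDR hx)
    rw [toUnit, norm_smul, norm_inv, Real.norm_of_nonneg hr.le, inv_mul_lt_iff₀ hr] at h1
    rw [mem_closedBall_iff_norm]
    refine h1.le.trans (le_of_eq ?_)
    simp only [r]; field_simp
  have hsub : tsupport w ⊆ Metric.closedBall c (1 / 4) := by
    refine closure_minimal (fun x hx => hEball ?_) Metric.isClosed_closedBall
    by_contra hn
    exact hx (by simp only [w]; rw [h0 _ hn, smul_zero])
  have hcs : HasCompactSupport w :=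
    (isCompact_closedBall c (1 / 4)).of_isClosed_subset (isClosed_tsupport _) hsub
  have hEY : E ⊆ unitCube N := hEball.trans closedBall_subset_unitCube
  have key := relaxZ_le_lintegral_of_lipschitz hfin F hw hcs (hsub.trans closedBall_subset_unitCube)
  have hYm := (isOpen_unitCube N).measurableSet
  -- Off the closure of `E` the function `w` is locally zero, and the remaining points lie on the
  -- scaled boundary of `D`. This is where `|∂D| = 0` enters.
  have hout : ∫⁻ y in unitCube N \ E, relaxZ b W (F + gradMat w y)
      = volume (unitCube N \ E) * relaxZ b W F := by
    rw [setLIntegral_congr_fun_ae (g := fun _ => relaxZ b W F) (hYm.diff hEo.measurableSet),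
      setLIntegral_const, mul_comm]
    have hf0 : volume (toUnit c r ⁻¹' frontier D) = 0 := by
      rw [volume_preimage_toUnit c hr, hDf, mul_zero]
    have hf1 : ∀ᵐ x ∂(volume : Measure (Euc N)), x ∉ toUnit c r ⁻¹' frontier D :=
      measure_eq_zero_iff_ae_notMem.1 hf0
    filter_upwards [hf1] with x hx hxE
    have hxD : toUnit c r x ∉ closure D := fun h =>
      hx ⟨h, by rw [hD.interior_eq]; exact hxE.2⟩
    rw [hgrad, gradMat_congr (v := fun _ => 0), gradMat_zero, add_zero]
    filter_upwards [isClosed_closure.isOpen_compl.mem_nhds hxD] with y hy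
    exact h0 y fun h => hy (subset_closure h)
  have hvol : volume E + volume (unitCube N \ E) = 1 := by
    rw [measure_add_sdiff hEo.measurableSet.nullMeasurableSet, union_eq_self_of_subset_left hEY,
      volume_unitCube]
  have hsplit : ∫⁻ y in unitCube N, relaxZ b W (F + gradMat w y) =
      (∫⁻ y in E, relaxZ b W (F + gradMat w y)) + volume (unitCube N \ E) * relaxZ b W F := by
    rw [← hout, ← lintegral_inter_add_sdiff _ _ hEo.measurableSet,
      inter_eq_self_of_subset_right hEY]
  -- Finiteness allows the contribution outside `E` to be cancelled from both sides.
  have hne : volume (unitCube N \ E) * relaxZ b W F ≠ ⊤ := by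
    refine ENNReal.mul_ne_top ?_ (hfin F)
    exact ne_top_of_le_ne_top ENNReal.one_ne_top (hvol ▸ le_add_self)
  rw [hsplit] at key
  have h1 : volume E * relaxZ b W F + volume (unitCube N \ E) * relaxZ b W F ≤
      (∫⁻ y in E, relaxZ b W (F + gradMat w y)) + volume (unitCube N \ E) * relaxZ b W F := by
    rw [← add_mul, hvol, one_mul]
    exact key
  have h2 := (ENNReal.add_le_add_iff_right hne).1 h1
  simp only [hgrad] at h2
  rw [setLIntegral_comp_toUnit c hr D fun y => relaxZ b W (F + gradMat u y),
    volume_preimage_toUnit c hr, mul_assoc] at h2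
  refine (ENNReal.mul_le_mul_iff_right ?_ ENNReal.ofReal_ne_top).1 h2
  exact (ENNReal.ofReal_pos.2 (by positivity)).ne'

/-! ### Sobolev functions versus Lipschitz functions -/

theorem opNorm_le_of_coords {l : Euc N →L[ℝ] ℝ} {B : ℝ} (hB : 0 ≤ B)
    (h : ∀ j, |l (EuclideanSpace.single j 1)| ≤ B) : ‖l‖ ≤ N * B := by
  refine l.opNorm_le_bound (by positivity) fun v => ?_
  have hv : v = ∑ j, v j • (EuclideanSpace.single j (1 : ℝ) : Euc N) := by
    ext i
    simp [Pi.single_apply]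
  calc ‖l v‖ = ‖∑ j, v j • l (EuclideanSpace.single j (1 : ℝ))‖ := by
        conv_lhs => rw [hv, map_sum]
        simp only [map_smul]
    _ ≤ ∑ j, ‖v j • l (EuclideanSpace.single j (1 : ℝ))‖ := norm_sum_le _ _
    _ ≤ ∑ _j : Fin N, ‖v‖ * B := by
        refine Finset.sum_le_sum fun j _ => ?_
        rw [norm_smul]
        exact mul_le_mul (PiLp.norm_apply_le v j) (h j) (norm_nonneg _) (norm_nonneg _)
    _ = N * B * ‖v‖ := by simp; ring

/-- A continuous function with bounded weak derivatives is Lipschitz along segments. -/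
theorem dist_le_of_segment_subset {D : Set (Euc N)} (hD : IsOpen D) {f : Euc N → ℝ}
    {g : Fin N → Euc N → ℝ} (hf : LocallyIntegrable f volume) (hfc : ContinuousOn f D)
    (hweak : ∀ j, ∀ η : Euc N → ℝ, ContDiff ℝ ∞ η → HasCompactSupport η → tsupport η ⊆ D →
      ∫ x, f x * fderiv ℝ η x (EuclideanSpace.single j 1) = -∫ x, g j x * η x)
    {B : ℝ} (hB0 : 0 ≤ B) (hB : ∀ j, ∀ᵐ x ∂(volume : Measure (Euc N)), |g j x| ≤ B) {x y : Euc N}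
    (hxy : segment ℝ x y ⊆ D) : dist (f x) (f y) ≤ N * B * dist x y := by
  have hcomp : IsCompact (segment ℝ x y) := by
    rw [segment_eq_image_lineMap]
    exact isCompact_Icc.image AffineMap.lineMap_continuous
  obtain ⟨r, hr, hrD⟩ := hcomp.exists_cthickening_subset_open hD hxy
  let φ := bumpSeq N hr
  let w : ℕ → Euc N → ℝ := fun n =>
    (φ n).normed volume ⋆[ContinuousLinearMap.lsmul ℝ ℝ, volume] f
  have hw : ∀ n, Differentiable ℝ (w n) := fun n =>
    ((φ n).hasCompactSupport_normed.contDiff_convolution_left _ (n := 1) (φ n).contDiff_normed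
      hf).differentiable one_ne_zero
  have hle : ∀ n, dist (w n x) (w n y) ≤ N * B * dist x y := by
    intro n
    rw [dist_comm, dist_eq_norm, dist_comm x y, dist_eq_norm]
    refine (convex_segment x y).norm_image_sub_le_of_norm_fderiv_le (𝕜 := ℝ)
      (fun z _ => hw n z) (fun z hz => ?_) (left_mem_segment ℝ x y) (right_mem_segment ℝ x y)
    refine opNorm_le_of_coords hB0 fun j => ?_
    rw [fderiv_mollify hf (hweak j) (φ n)]
    · exact abs_mollify_le _ (hB j) z
    · refine Subset.trans (fun a ha => ?_) hrD
      refine Metric.mem_cthickening_of_dist_le a z r _ hz ?_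
      exact (Metric.mem_closedBall.1 ha).trans (bumpSeq_rOut_le hr n)
  have hlim : ∀ z ∈ D, Tendsto (fun n => w n z) atTop (𝓝 (f z)) := fun z hz =>
    ContDiffBump.convolution_tendsto_right (g := fun _ => f) (k := fun _ => z)
      (tendsto_bumpSeq_rOut hr)
      (Eventually.of_forall fun _ => hf.aestronglyMeasurable)
      (((hfc.continuousAt (hD.mem_nhds hz)).tendsto).comp tendsto_snd) tendsto_const_nhds
  exact le_of_tendsto' ((hlim x (hxy (left_mem_segment ℝ x y))).dist
    (hlim y (hxy (right_mem_segment ℝ x y)))) hle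

theorem exists_ae_bound_indicator {D : Set (Euc N)} (hD : IsOpen D) {g : Euc N → ℝ}
    (hg : MemLp g ∞ (volume.restrict D)) : ∃ B, 0 ≤ B ∧
      AEStronglyMeasurable (D.indicator g) (volume : Measure (Euc N)) ∧
      ∀ᵐ x ∂(volume : Measure (Euc N)), |D.indicator g x| ≤ B := by
  have h := (memLp_indicator_iff_restrict hD.measurableSet).2 hg
  refine ⟨(eLpNorm (D.indicator g) ∞ volume).toReal, ENNReal.toReal_nonneg, h.1, ?_⟩
  have h2 := ae_le_eLpNormEssSup (f := D.indicator g) (μ := (volume : Measure (Euc N)))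
  rw [← eLpNorm_exponent_top] at h2
  filter_upwards [h2] with x hx
  rw [← Real.norm_eq_abs, ← toReal_enorm]
  exact ENNReal.toReal_mono h.2.ne hx

theorem integral_indicator_mul {D : Set (Euc N)} (hD : IsOpen D) (g h : Euc N → ℝ) :
    ∫ x, D.indicator g x * h x = ∫ x in D, g x * h x := by
  rw [← integral_indicator hD.measurableSet]
  refine integral_congr_ae (Eventually.of_forall fun x => ?_)
  by_cases hx : x ∈ D <;> simp [hx]

/-- The extension by zero of a function in `W^{1,∞}_0(D)` is Lipschitz, and its gradient is the weak
gradient. -/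
theorem IsW1InfZero.lipschitz_indicator {D : Set (Euc N)} (hD : IsOpen D)
    {φ : Euc N → Euc m} {G : Euc N → Mat m N} (h : IsW1InfZero D φ G) :
    (∃ K, LipschitzWith K (D.indicator φ)) ∧
      ∀ᵐ x ∂(volume.restrict D), G x = gradMat (D.indicator φ) x := by
  have hcomp : ∀ i, (fun x => D.indicator φ x i) = D.indicator fun x => φ x i := by
    intro i; funext x
    by_cases hx : x ∈ D <;> simp [hx]
  have hφi : ∀ i, MemLp (fun x => φ x i) ∞ (volume.restrict D) := fun i =>
    h.memLp.of_le ((EuclideanSpace.proj (𝕜 := ℝ) i).continuous.comp_aestronglyMeasurable h.memLp.1)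
      (Eventually.of_forall fun x => PiLp.norm_apply_le (φ x) i)
  have hweak : ∀ i j, ∀ η : Euc N → ℝ, ContDiff ℝ ∞ η → HasCompactSupport η → tsupport η ⊆ D →
      ∫ x, D.indicator (fun x => φ x i) x * fderiv ℝ η x (EuclideanSpace.single j 1)
        = -∫ x, D.indicator (fun x => G x i j) x * η x := by
    intro i j η hη hηc hηD
    rw [integral_indicator_mul hD, integral_indicator_mul hD]
    exact h.weak_grad η hη hηc hηD i j
  have hloc : ∀ i, LocallyIntegrable (D.indicator fun x => φ x i) volume := fun i => by
    obtain ⟨B, -, hm, hB⟩ := exists_ae_bound_indicator hD (hφi i)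
    exact locallyIntegrable_of_ae_bound hm hB
  choose B hB0 hBm hB using fun i j => exists_ae_bound_indicator hD (h.memLp_grad i j)
  have hlip : ∃ K, LipschitzWith K (D.indicator φ) := by
    refine exists_lipschitz_of_components fun i => ?_
    have hM : ∀ j, B i j ≤ ∑ j, B i j := fun j =>
      Finset.single_le_sum (f := fun j => B i j) (fun j _ => hB0 i j) (Finset.mem_univ j)
    have hM0 : 0 ≤ ∑ j, B i j := Finset.sum_nonneg fun j _ => hB0 i j
    have hφc : ContinuousOn (fun x => φ x i) (closure D) :=
      (EuclideanSpace.proj (𝕜 := ℝ) i).continuous.comp_continuousOn h.continuousOn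
    refine ⟨⟨N * ∑ j, B i j, by positivity⟩, ?_⟩
    rw [hcomp i]
    refine lipschitzWith_indicator hD (fun x y hxy => ?_) hφc fun x hx => by simp [h.eq_zero x hx]
    have h1 := dist_le_of_segment_subset hD (hloc i)
      ((hφc.mono subset_closure).congr fun x hx => indicator_of_mem hx _) (hweak i) hM0
      (fun j => (hB i j).mono fun x hx => hx.trans (hM j)) hxy
    rwa [indicator_of_mem (hxy (left_mem_segment ℝ x y)),
      indicator_of_mem (hxy (right_mem_segment ℝ x y))] at h1
  refine ⟨hlip, ?_⟩
  obtain ⟨K, hK⟩ := hlip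
  -- Both the weak gradient and the classical derivative of the Lipschitz extension integrate by
  -- parts against tests supported in `D`; their difference annihilates all of these.
  have hzero : ∀ i j, ∀ᵐ x ∂(volume : Measure (Euc N)), x ∈ D →
      D.indicator (fun x => G x i j) x
        - fderiv ℝ (fun y => D.indicator φ y i) x (EuclideanSpace.single j 1) = 0 := by
    intro i j
    have hl1 : LocallyIntegrable (D.indicator fun x => G x i j) volume :=
      locallyIntegrable_of_ae_bound (hBm i j) (hB i j)
    have hl2 : LocallyIntegrable (fun x =>
        fderiv ℝ (fun y => D.indicator φ y i) x (EuclideanSpace.single j 1)) volume :=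
      locallyIntegrable_of_ae_bound (measurable_fderiv_apply_real _ _).aestronglyMeasurable
        (Eventually.of_forall (abs_fderiv_component_le hK i j))
    refine hD.ae_eq_zero_of_integral_contDiff_smul_eq_zero
      ((hl1.sub hl2).locallyIntegrableOn D) fun η hη hηc hηD => ?_
    have e1 := hweak i j η hη hηc hηD
    have e2 := integral_mul_fderiv_eq_neg (lipschitz_component hK i) hη hηc
      (EuclideanSpace.single j 1)
    have e0 : ∀ x, D.indicator φ x i = D.indicator (fun x => φ x i) x := congrFun (hcomp i)
    simp only [← e0] at e1
    have i1 := hl1.integrable_smul_left_of_hasCompactSupport hη.continuous hηc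
    have i2 := hl2.integrable_smul_left_of_hasCompactSupport hη.continuous hηc
    simp only [smul_sub]
    rw [integral_sub i1 i2, sub_eq_zero]
    simp only [smul_eq_mul, mul_comm (η _)]
    linarith
  rw [ae_restrict_iff' hD.measurableSet]
  filter_upwards [ae_all_iff.2 fun i => ae_all_iff.2 (hzero i), hK.ae_differentiableAt]
    with x hx hxd hxD
  ext i j
  have h1 := hx i j hxD
  rw [fderiv_component_apply hxd, indicator_of_mem hxD, sub_eq_zero] at h1
  exact h1

/-- Lipschitz functions vanishing off a bounded open set belong to `W^{1,∞}_0`. -/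
theorem isW1InfZero_of_lipschitz {D : Set (Euc N)} (hD : IsOpen D) (hDb : Bornology.IsBounded D)
    {u : Euc N → Euc m} {K : ℝ≥0} (hu : LipschitzWith K u) (h0 : ∀ x ∉ D, u x = 0) :
    IsW1InfZero D u (gradMat u) where
  memLp := by
    obtain ⟨C, hC⟩ := hDb.isCompact_closure.exists_bound_of_continuousOn hu.continuous.continuousOn
    refine memLp_top_of_bound hu.continuous.aestronglyMeasurable C ?_
    filter_upwards [ae_restrict_mem hD.measurableSet] with x hx using hC x (subset_closure hx)
  memLp_grad := by
    intro i j
    have hm : Measurable fun x => gradMat u x i j :=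
      (continuous_id.matrix_elem i j : Continuous fun A : Mat m N => A i j).measurable.comp
        (measurable_gradMat u)
    exact memLp_top_of_bound hm.aestronglyMeasurable K
      (Eventually.of_forall fun x => abs_gradMat_le hu x i j)
  weak_grad := by
    intro η hη hηc hηD i j
    have h1 := integral_mul_fderiv_eq_neg (lipschitz_component hu i) hη hηc
      (EuclideanSpace.single j 1)
    rw [setIntegral_eq_integral_of_forall_compl_eq_zero fun x hx => by simp [h0 x hx],
      setIntegral_eq_integral_of_forall_compl_eq_zero fun x hx => by
        rw [image_eq_zero_of_notMem_tsupport fun h => hx (hηD h), mul_zero], h1]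
    congr 1
    refine integral_congr_ae ?_
    filter_upwards [hu.ae_differentiableAt (μ := volume)] with x hx
    rw [fderiv_component_apply hx]
  continuousOn := hu.continuous.continuousOn
  eq_zero := by
    intro x hx
    rw [frontier, hD.interior_eq] at hx
    exact h0 x hx.2

theorem isBounded_unitCube (N : ℕ) : Bornology.IsBounded (unitCube N) :=
  (isCompact_closure_unitCube N).isBounded.subset subset_closure

/-- The pieces are the regions of constant gradient. Disjoint open sets do not meet each other's
closures, so the frontier of a piece lies in `∂D` or in the uncovered part of `D`, both null. -/
theorem FinGrad.isPiecewiseConst {D : Set (Euc N)} (hD : IsOpen D)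
    (hDf : volume (frontier D) = 0) {u : Euc N → Euc m} (hu : FinGrad D u) :
    IsPiecewiseConst D (gradMat u) := by
  obtain ⟨S₀, hS₀, hae⟩ := hu
  obtain ⟨S, rfl⟩ := hS₀.exists_finset_coe
  let e := S.equivFin.symm
  let V : Fin S.card → Set (Euc N) := fun k => gradRegion u (e k).1 ∩ D
  have hVo : ∀ k, IsOpen (V k) := fun k => (isOpen_gradRegion u _).inter hD
  have hVd : ∀ k l, k ≠ l → Disjoint (V k) (V l) := fun k l hkl =>
    (disjoint_gradRegion u fun h => hkl (e.injective (Subtype.ext h))).mono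
      inter_subset_left inter_subset_left
  have hcov : volume (D \ ⋃ k, V k) = 0 := by
    rw [ae_restrict_iff' hD.measurableSet, ae_iff] at hae
    refine measure_mono_null ?_ hae
    rintro x ⟨hxD, hx⟩ hx'
    obtain ⟨A, hA, hev⟩ := hx' hxD
    refine hx (mem_iUnion.2 ⟨e.symm ⟨A, hA⟩, ?_, hxD⟩)
    show x ∈ gradRegion u (e (e.symm ⟨A, hA⟩)).1
    rw [Equiv.apply_symm_apply]
    exact hev
  refine ⟨S.card, V, fun k => (e k).1, hVo, fun k => inter_subset_right, hVd, fun k => ?_, hcov,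
    fun k => ?_⟩
  · refine measure_mono_null ?_ (measure_union_null hDf hcov)
    intro x hx
    rw [frontier, (hVo k).interior_eq] at hx
    by_cases hxD : x ∈ D
    · refine Or.inr ⟨hxD, fun hxV => ?_⟩
      obtain ⟨l, hl⟩ := mem_iUnion.1 hxV
      by_cases hkl : k = l
      · exact hx.2 (hkl ▸ hl)
      · exact (Set.disjoint_left.1 ((hVd k l hkl).closure_left (hVo l))) hx.1 hl
    · refine Or.inl ⟨closure_mono inter_subset_right hx.1, ?_⟩
      rwa [hD.interior_eq]
  · exact ae_restrict_of_ae_restrict_of_subset inter_subset_left (ae_gradRegion u _)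

theorem IsPiecewiseConst.finGrad {D : Set (Euc N)} (hD : IsOpen D) {G : Euc N → Mat m N}
    (hG : IsPiecewiseConst D G) {u : Euc N → Euc m}
    (hu : ∀ᵐ x ∂(volume.restrict D), G x = gradMat u x) : FinGrad D u := by
  obtain ⟨n, V, A, hVo, hVD, -, -, hcov, hVA⟩ := hG
  refine ⟨range A, Set.finite_range A, ?_⟩
  have h1 : ∀ᵐ x ∂(volume : Measure (Euc N)), x ∉ D \ ⋃ i, V i :=
    measure_eq_zero_iff_ae_notMem.1 hcov
  rw [ae_restrict_iff' hD.measurableSet]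
  filter_upwards [h1] with x hx hxD
  have hxV : x ∈ ⋃ i, V i := by
    by_contra hn
    exact hx ⟨hxD, hn⟩
  obtain ⟨i, hi⟩ := mem_iUnion.1 hxV
  refine ⟨A i, ⟨i, rfl⟩, eventually_nhds_inf_ae_of_isOpen (hVo i) hi ?_⟩
  filter_upwards [hVA i, ae_restrict_of_ae_restrict_of_subset (hVD i) hu] with y hy1 hy2
  rw [← hy2, hy1]

/-! ### Identification of the two infima -/

/-- A Lipschitz competitor has `gradMat u` as weak gradient; a Sobolev competitor is replaced by its
extension by zero, which changes the integrand only on a null set. -/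
theorem ZInf_eq_relaxZ (W : Mat m N → ℝ≥0∞) : ZInf W = relaxZ False W := by
  funext F
  refine le_antisymm ?_ ?_
  · refine le_iInf₂ fun u hu => ?_
    obtain ⟨K, hK⟩ := hu.lipschitz
    exact iInf_le_of_le u (iInf₂_le (gradMat u)
      (isW1InfZero_of_lipschitz (isOpen_unitCube N) (isBounded_unitCube N) hK hu.zero_off))
  · refine le_iInf fun φ => le_iInf₂ fun G hG => ?_
    obtain ⟨hlip, hgrad⟩ := hG.lipschitz_indicator (isOpen_unitCube N)
    refine (relaxZ_le ⟨hlip, fun x hx => indicator_of_notMem hx _, False.elim⟩).trans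
      (le_of_eq (lintegral_congr_ae ?_))
    filter_upwards [hgrad] with x hx
    rw [hx]

theorem ZAff_eq_relaxZ (W : Mat m N → ℝ≥0∞) : ZAff W = relaxZ True W := by
  funext F
  refine le_antisymm ?_ ?_
  · refine le_iInf₂ fun u hu => ?_
    obtain ⟨K, hK⟩ := hu.lipschitz
    exact iInf_le_of_le u (iInf₂_le (gradMat u)
      ⟨isW1InfZero_of_lipschitz (isOpen_unitCube N) (isBounded_unitCube N) hK hu.zero_off,
        (hu.fin_grad trivial).isPiecewiseConst (isOpen_unitCube N) (volume_frontier_unitCube N)⟩)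
  · refine le_iInf fun φ => le_iInf₂ fun G hG => ?_
    obtain ⟨hlip, hgrad⟩ := hG.toIsW1InfZero.lipschitz_indicator (isOpen_unitCube N)
    refine (relaxZ_le ⟨hlip, fun x hx => indicator_of_notMem hx _,
      fun _ => hG.piecewise.finGrad (isOpen_unitCube N) hgrad⟩).trans
      (le_of_eq (lintegral_congr_ae ?_))
    filter_upwards [hgrad] with x hx
    rw [hx]

/-! ### Quasiconvexity and the envelope -/

/-- If the relaxed density is finite, then it is quasiconvex. -/
theorem isQuasiconvex_relaxZ {b : Prop} {W : Mat m N → ℝ≥0∞} (hfin : ∀ F, relaxZ b W F ≠ ⊤) :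
    IsQuasiconvex (relaxZ b W) where
  measurable := (continuous_relaxZ hfin).measurable
  le_lintegral := by
    intro F D hD hDb hDf φ G hG
    obtain ⟨⟨K, hK⟩, hgrad⟩ := hG.lipschitz_indicator hD
    refine (volume_mul_relaxZ_le hfin F hD hDb hDf hK fun x hx => indicator_of_notMem hx _).trans
      (le_of_eq (lintegral_congr_ae ?_))
    filter_upwards [hgrad] with x hx
    rw [hx]

theorem relaxZ_le_self {b : Prop} (W : Mat m N → ℝ≥0∞) : relaxZ b W ≤ W := by
  intro F
  have h : Adm b (unitCube N) fun _ => (0 : Euc m) := by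
    refine ⟨⟨0, LipschitzWith.const 0⟩, fun _ _ => rfl, fun _ => ⟨{0}, Set.finite_singleton 0, ?_⟩⟩
    exact Eventually.of_forall fun x => ⟨0, rfl, Eventually.of_forall fun y => gradMat_zero y⟩
  refine (relaxZ_le h).trans (le_of_eq ?_)
  simp only [gradMat_zero, add_zero, setLIntegral_const, volume_unitCube, mul_one]

theorem relaxZ_anti {b c : Prop} (hbc : b → c) (W : Mat m N → ℝ≥0∞) : relaxZ b W ≤ relaxZ c W :=
  fun _ => le_iInf₂ fun _ hu => relaxZ_le ⟨hu.lipschitz, hu.zero_off, fun h => hu.fin_grad (hbc h)⟩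

/-- Quasiconvex minorants lie below the relaxed density. -/
theorem le_ZInf_of_mem_quasiconvexMinorants {W g : Mat m N → ℝ≥0∞}
    (hg : g ∈ quasiconvexMinorants W) : g ≤ ZInf W := by
  intro F
  refine le_iInf fun φ => le_iInf₂ fun G hG => ?_
  have h := hg.1.le_lintegral F (unitCube N) (isOpen_unitCube N) (isBounded_unitCube N)
    (volume_frontier_unitCube N) φ G hG
  rw [volume_unitCube, one_mul] at h
  exact h.trans (lintegral_mono fun y => hg.2 _)

theorem isGreatest_relaxZ {b : Prop} {W : Mat m N → ℝ≥0∞} (hfin : ∀ F, relaxZ b W F ≠ ⊤) :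
    IsGreatest (quasiconvexMinorants W) (relaxZ b W) := by
  refine ⟨⟨isQuasiconvex_relaxZ hfin, relaxZ_le_self W⟩, fun g hg => ?_⟩
  refine (le_ZInf_of_mem_quasiconvexMinorants hg).trans ?_
  rw [ZInf_eq_relaxZ]
  exact relaxZ_anti False.elim W

end Relaxation

theorem mainTheorem4 (m N : ℕ) (hm : 1 < m) (hN : 1 < N) (p : ℝ) (hp : 1 < p)
    (W : Relaxation.Mat m N → ENNReal) (hW : Measurable W)
    (hcoer : Relaxation.IsCoercive p W) :
    ((∀ F, Relaxation.ZInf W F ≠ ⊤) →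
      IsGreatest (Relaxation.quasiconvexMinorants W) (Relaxation.quasiconvexEnvelope W) ∧
      Relaxation.quasiconvexEnvelope W = Relaxation.ZInf W) ∧
    ((∀ F, Relaxation.ZAff W F ≠ ⊤) →
      IsGreatest (Relaxation.quasiconvexMinorants W) (Relaxation.quasiconvexEnvelope W) ∧
      Relaxation.quasiconvexEnvelope W = Relaxation.ZAff W ∧
      Relaxation.ZAff W = Relaxation.ZInf W) := by
  have key : ∀ b : Prop, (∀ F, Relaxation.relaxZ b W F ≠ ⊤) →
      IsGreatest (Relaxation.quasiconvexMinorants W) (Relaxation.quasiconvexEnvelope W) ∧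
        Relaxation.quasiconvexEnvelope W = Relaxation.relaxZ b W := by
    intro b hfin
    have h := Relaxation.isGreatest_relaxZ hfin
    -- The supremum of a family with a greatest element is that element.
    have he : Relaxation.quasiconvexEnvelope W = Relaxation.relaxZ b W := h.isLUB.sSup_eq
    exact ⟨he ▸ h, he⟩
  rw [Relaxation.ZInf_eq_relaxZ, Relaxation.ZAff_eq_relaxZ]
  refine ⟨key False, fun hfin => ?_⟩
  -- Finiteness over the smaller piecewise affine class passes to the larger class, so both infima
  -- equal the envelope.
  have hfin' : ∀ F, Relaxation.relaxZ False W F ≠ ⊤ := fun F =>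
    ne_top_of_le_ne_top (hfin F) (Relaxation.relaxZ_anti False.elim W F)
  obtain ⟨h1, h2⟩ := key True hfin
  exact ⟨h1, h2, h2.symm.trans (key False hfin').2⟩
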